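/- All graphs are finite, undirected, without loops or parallel edges. A graph is \emph{$2$-connected} if it has at least three vertices, is connected, and stays connected after the deletion of any one vertex; it is \emph{claw-free} if it has no induced subgraph isomorphic to $K_{1,3}$. A \emph{$\Lambda$-factor} of a graph is a spanning subgraph each of whose connected components is a path with exactly three vertices. Write $v(G)$ for the number of vertices of $G$, and $G-\{x,z\}$ for the graph obtained from $G$ by deleting the two vertices $x$ and $z$. Let $G$ be a $2$-connected claw-free graph with $v(G) \equiv 2 \pmod 3$, and let $x$ be a vertex of $G$. Then there exist at least two distinct edges $xz_1$ and $xz_2$ of $G$ such that, for each $i \in \{1,2\}$, the graph $G - \{x, z_i\}$ is connected and has a $\Lambda$-factor. -/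

import Mathlib

/-- `G` is `k`-connected: it has more than `k` vertices, and it stays connected after the deletion
of any fewer than `k` vertices. In particular `K₂` is not `2`-connected. -/
def SimpleGraph.IsVertexConnected {V : Type*} [Fintype V] (G : SimpleGraph V) (k : ℕ) : Prop :=
  k < Fintype.card V ∧ ∀ S : Finset V, S.card < k → (G.induce ((S : Set V)ᶜ)).Connected

/-- `G` is claw-free: it has no induced subgraph isomorphic to `K_{1,3}`. -/
def SimpleGraph.IsClawFree {V : Type*} (G : SimpleGraph V) : Prop :=
  ¬ (completeBipartiteGraph (Fin 1) (Fin 3)).IsIndContained G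

/-- `G` has an `H`-factor: a spanning subgraph `F` of `G` (same vertex set, `F ≤ G`) each of whose
connected components is isomorphic to `H`. -/
def SimpleGraph.HasFactor {V W : Type*} (G : SimpleGraph V) (H : SimpleGraph W) : Prop :=
  ∃ F : SimpleGraph V, F ≤ G ∧ ∀ c : F.ConnectedComponent, Nonempty (c.toSimpleGraph ≃g H)

/-- `G` has a `Λ`-factor, where `Λ` is the path with three vertices. -/
def SimpleGraph.HasLambdaFactor {V : Type*} (G : SimpleGraph V) : Prop :=
  G.HasFactor (SimpleGraph.pathGraph 3)

set_option linter.unusedSectionVars false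

/-! Call a nonempty vertex set an end-piece if at most one vertex outside it has a neighbour in it.
"At most two end-blocks" then means that no three end-pieces are pairwise disjoint and nonadjacent
(`Good`). The core is `Good.tiles`: a connected claw-free graph with at most two end-blocks and
order divisible by three has a Λ-factor.

Deduction of the theorem. If `G - x` has no cut vertex, every neighbour `z` of `x` serves: three
separated end-pieces of `G - x - z` would each contain a neighbour of `z` and produce a claw. If `G
- x` has a cut vertex, each of its sides contains an end-block (`Good.exists_end_block`), and each
of the two supplies its own `z`. Let `c` be the vertex attaching such an end-block. A common
neighbour of `x` and `c` inside it serves directly (`NoCut.good_erase_erase`). If there is none,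
keep only the edges from `x` into the end-block and add a pendant vertex at `x`. The new graph is
still claw-free with at most two end-blocks, and its order is divisible by three. In a Λ-factor of
it the pendant vertex lies in a path through `x` to some `z` in the end-block, and the other paths
tile `G - x - z`.

`Good.tiles` is a strong induction on the order, splitting the graph along small separators
according to residues modulo three. Claw-freeness makes the neighbours of a cut vertex on one side a
clique, so the pieces stay in the class. Without cut vertices, one splits along two or three
vertices or removes one path. With a cut vertex, the difficulty is a side consisting of a single
vertex. The hardest case is a block with two pendant vertices, `p` at `c` and `r` at `q`
(`NoCut.tiles_insert_insert`). There one removes `p`, `c` and a neighbour `z` of `c`. If the rest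
has too many end-blocks, it contains a chain arm, centre, arm (`Arms`), and `p`, `c`, `z` are
distributed over the two arms so that the residues fit. -/

namespace LambdaFactor

variable {V : Type*} [DecidableEq V]

/-! ### Connectivity and end-blocks in terms of vertex sets -/

/-- `G` has no induced claw, in elementary terms. -/
def NoClaw {V : Type*} (G : SimpleGraph V) : Prop :=
  ∀ a b c d, G.Adj a b → G.Adj a c → G.Adj a d → b ≠ c → b ≠ d → c ≠ d →
    G.Adj b c ∨ G.Adj b d ∨ G.Adj c d

/-- Every neighbour of `E` in `U \ E` is the vertex `v`. -/
def Bdry {V : Type*} (G : SimpleGraph V) (U E : Finset V) (v : V) : Prop :=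
  ∀ e ∈ E, ∀ u ∈ U, u ∉ E → G.Adj e u → u = v

/-- `E` has no neighbour in `U \ E`. -/
def Closed {V : Type*} (G : SimpleGraph V) (U E : Finset V) : Prop :=
  ∀ e ∈ E, ∀ u ∈ U, G.Adj e u → u ∈ E

/-- `U` induces a connected subgraph. -/
def Conn {V : Type*} (G : SimpleGraph V) (U : Finset V) : Prop :=
  U.Nonempty ∧ ∀ E ⊆ U, E.Nonempty → Closed G U E → U ⊆ E

/-- `U` induces a connected subgraph without cut vertices. -/
def NoCut (G : SimpleGraph V) (U : Finset V) : Prop :=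
  U.Nonempty ∧ ∀ E ⊆ U, E.Nonempty → ∀ v, Bdry G U E v → U ⊆ insert v E

/-- `E` and `F` are disjoint and no edge joins them. -/
def Apart {V : Type*} (G : SimpleGraph V) (E F : Finset V) : Prop :=
  ∀ e ∈ E, ∀ f ∈ F, e ≠ f ∧ ¬ G.Adj e f

/-- `U` induces a connected subgraph with at most two end-blocks. -/
def Good {V : Type*} (G : SimpleGraph V) (U : Finset V) : Prop :=
  Conn G U ∧ ∀ E₁ ⊆ U, ∀ E₂ ⊆ U, ∀ E₃ ⊆ U, E₁.Nonempty → E₂.Nonempty → E₃.Nonempty →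
    ∀ v₁ v₂ v₃, Bdry G U E₁ v₁ → Bdry G U E₂ v₂ → Bdry G U E₃ v₃ →
    Apart G E₁ E₂ → Apart G E₁ E₃ → Apart G E₂ E₃ → False

/-- `S` is a set of pairwise adjacent vertices. -/
def Clique {V : Type*} (G : SimpleGraph V) (S : Finset V) : Prop :=
  ∀ a ∈ S, ∀ b ∈ S, a ≠ b → G.Adj a b

/-- `U` induces a connected subgraph, and every set with at most one neighbour in `U` meets
`S` or `T`. -/
def Ended {V : Type*} (G : SimpleGraph V) (U S T : Finset V) : Prop :=
  Conn G U ∧ ∀ E ⊆ U, E.Nonempty → (∀ s ∈ S, s ∉ E) → (∀ t ∈ T, t ∉ E) → ∀ v, ¬ Bdry G U E v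

/-- `A` and `B` are the two sides of the cut vertex `c` of `U`. -/
structure IsCut (G : SimpleGraph V) (U A : Finset V) (c : V) (B : Finset V) : Prop where
  eq : U = insert c (A ∪ B)
  left : A.Nonempty
  right : B.Nonempty
  notMem_left : c ∉ A
  notMem_right : c ∉ B
  apart : Apart G A B

/-- `U` is partitioned into vertex sets of paths with three vertices. -/
inductive Tiles (G : SimpleGraph V) : Finset V → Prop
  | empty : Tiles G ∅
  | step {U : Finset V} {a b c : V} : Tiles G U → G.Adj a b → G.Adj b c → a ≠ c →
      a ∉ U → b ∉ U → c ∉ U → Tiles G (insert a (insert b (insert c U)))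

variable {G : SimpleGraph V} {U W A B D E F S T X Y : Finset V} {a b c d p v x y z : V}

/-! ### Simplicial vertices and criteria for at most two end-blocks -/

lemma Apart.symm (h : Apart G E F) : Apart G F E := fun f hf e he =>
  ⟨(h e he f hf).1.symm, fun hh => (h e he f hf).2 hh.symm⟩

lemma IsCut.symm (h : IsCut G U A c B) : IsCut G U B c A :=
  ⟨by rw [h.eq, Finset.union_comm], h.right, h.left, h.notMem_right, h.notMem_left, h.apart.symm⟩

lemma NoCut.conn (h : NoCut G U) : Conn G U := by
  refine ⟨h.1, fun E hE ⟨e, he⟩ hc => ?_⟩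
  have := h.2 E hE ⟨e, he⟩ e (fun a ha u hu hu' hau => (hu' (hc a ha u hu hau)).elim)
  rwa [Finset.insert_eq_of_mem he] at this

lemma NoCut.conn_erase (h : NoCut G U) (hne : (U.erase z).Nonempty) : Conn G (U.erase z) := by
  refine ⟨hne, fun E hE hEne hc => ?_⟩
  have := h.2 E (by grind) hEne z (fun a ha u hu hu' hau => by
    have := hc a ha u
    grind)
  grind

lemma Conn.insert_vertex (h : Conn G U) (ha : a ∈ U) (hpa : G.Adj p a) : Conn G (insert p U) := by
  refine ⟨by simp, fun E hE hEne hc => ?_⟩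
  by_cases hp : p ∈ E
  · have haE : a ∈ E := hc p hp a (by simp [ha]) hpa
    have := h.2 (E ∩ U) (by grind) ⟨a, by grind⟩ (fun e he u hu heu => by
      have := hc e (by grind) u (by grind) heu
      grind)
    grind
  · have hEU : E ⊆ U := by grind
    have := h.2 E hEU hEne (fun e he u hu heu => hc e he u (by grind) heu)
    have := hc a (this ha) p (by simp) hpa.symm
    contradiction

/-- Adding to `E` the vertex `v` if `E` has it as a neighbour. -/
lemma Bdry.extend (hcl : ∀ a ∈ U, ∀ b ∈ U, G.Adj v a → G.Adj v b → a ≠ b → G.Adj a b)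
    (hE : E ⊆ U.erase v) (h : Bdry G (U.erase v) E x) (hv : v ∈ U) :
    ∃ F ⊆ U, E ⊆ F ∧ F ⊆ insert v E ∧ Bdry G U F x ∧
      ((v ∈ F → ∃ e ∈ E, G.Adj v e) ∧ (v ∉ F → ∀ e ∈ E, ¬ G.Adj v e)) := by
  by_cases hh : ∃ e ∈ E, G.Adj v e
  · obtain ⟨e, he, hve⟩ := hh
    refine ⟨insert v E, by grind, by grind, by grind, ?_,
      fun _ => ⟨e, he, hve⟩, by grind⟩
    intro f hf u hu huE hfu
    rcases Finset.mem_insert.1 hf with rfl | hf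
    · exact h e he u (by grind) (by grind) (hcl e (by grind) u hu hve hfu (by grind))
    · exact h f hf u (by grind) (by grind) hfu
  · refine ⟨E, by grind, by grind, by grind, ?_, by grind, by grind⟩
    intro f hf u hu huE hfu
    refine h f hf u ?_ huE hfu
    have : u ≠ v := fun e => hh ⟨f, hf, e ▸ hfu.symm⟩
    grind

/-- A walk through `v` can be shortcut, as the neighbours of `v` are pairwise adjacent. In terms of
sets: a closed set of `U - v` becomes closed in `U` once `v` is added whenever it has a neighbour
there. -/
lemma Conn.erase (h : Conn G U) (hv : v ∈ U)
    (hcl : ∀ a ∈ U, ∀ b ∈ U, G.Adj v a → G.Adj v b → a ≠ b → G.Adj a b)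
    (hne : (U.erase v).Nonempty) : Conn G (U.erase v) := by
  refine ⟨hne, fun E hE hEne hc => ?_⟩
  by_cases hadj : ∃ e ∈ E, G.Adj v e
  · obtain ⟨e, he, hve⟩ := hadj
    have := h.2 (insert v E) (by grind) ⟨v, by simp⟩ (fun f hf u hu hfu => by
      have hne := hfu.ne
      rcases Finset.mem_insert.1 hf with rfl | hf
      · by_cases hue : u = e
        · grind
        · have := hc e he u (by grind) (hcl e (by grind) u hu hve hfu (by grind))
          grind
      · by_cases huv : u = v
        · grind
        · have := hc f hf u (by grind) hfu
          grind)
    grind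
  · have := h.2 E (by grind) hEne (fun f hf u hu hfu => by
      have : u ≠ v := fun e => hadj ⟨f, hf, e ▸ hfu.symm⟩
      exact hc f hf u (by grind) hfu)
    grind

/-- Three separated end-pieces of `U - v` extend to end-pieces of `U` by `Bdry.extend`. They remain
separated because `v` joins at most one of them. -/
lemma Good.erase (h : Good G U) (hv : v ∈ U)
    (hcl : ∀ a ∈ U, ∀ b ∈ U, G.Adj v a → G.Adj v b → a ≠ b → G.Adj a b)
    (hne : (U.erase v).Nonempty) : Good G (U.erase v) := by
  refine ⟨h.1.erase hv hcl hne, ?_⟩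
  intro E₁ h₁ E₂ h₂ E₃ h₃ n₁ n₂ n₃ v₁ v₂ v₃ b₁ b₂ b₃ a₁₂ a₁₃ a₂₃
  obtain ⟨F₁, hF₁, hE₁, hi₁, c₁, d₁⟩ := Bdry.extend hcl h₁ b₁ hv
  obtain ⟨F₂, hF₂, hE₂, hi₂, c₂, d₂⟩ := Bdry.extend hcl h₂ b₂ hv
  obtain ⟨F₃, hF₃, hE₃, hi₃, c₃, d₃⟩ := Bdry.extend hcl h₃ b₃ hv
  have key : ∀ E F E' F' : Finset V, E ⊆ U.erase v → F ⊆ U.erase v → Apart G E F →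
      E' ⊆ insert v E → (v ∈ E' → ∃ e ∈ E, G.Adj v e) → (v ∉ E' → ∀ e ∈ E, ¬ G.Adj v e) →
      F' ⊆ insert v F → (v ∈ F' → ∃ e ∈ F, G.Adj v e) → (v ∉ F' → ∀ e ∈ F, ¬ G.Adj v e) →
      Apart G E' F' := by
    intro E F E' F' hE hF hEF h1 h2 h3 h4 h5 h6 e he f hf
    -- The neighbours of `v` form a clique, so two separated sets cannot both contain one.
    have hno : ∀ e ∈ E, ∀ f ∈ F, G.Adj v e → G.Adj v f → False := fun e he f hf hve hvf =>
      (hEF e he f hf).2 (hcl e (by grind) f (by grind) hve hvf (hEF e he f hf).1)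
    have := G.adj_comm
    have := fun a b => G.ne_of_adj (a := a) (b := b)
    unfold Apart at hEF
    grind
  exact h.2 F₁ hF₁ F₂ hF₂ F₃ hF₃ (n₁.mono hE₁) (n₂.mono hE₂) (n₃.mono hE₃) v₁ v₂ v₃ c₁ c₂ c₃
    (key _ _ _ _ h₁ h₂ a₁₂ hi₁ d₁.1 d₁.2 hi₂ d₂.1 d₂.2)
    (key _ _ _ _ h₁ h₃ a₁₃ hi₁ d₁.1 d₁.2 hi₃ d₃.1 d₃.2)
    (key _ _ _ _ h₂ h₃ a₂₃ hi₂ d₂.1 d₂.2 hi₃ d₃.1 d₃.2)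

lemma NoCut.erase (h : NoCut G U) (hv : v ∈ U)
    (hcl : ∀ a ∈ U, ∀ b ∈ U, G.Adj v a → G.Adj v b → a ≠ b → G.Adj a b)
    (hne : (U.erase v).Nonempty) : NoCut G (U.erase v) := by
  refine ⟨hne, fun E hE hEne w hw => ?_⟩
  obtain ⟨F, hF, hEF, hFE, hb, -⟩ := Bdry.extend hcl hE hw hv
  have := h.2 F hF (hEne.mono hEF) w hb
  grind

/-- A connected subset of a graph without cut vertices, among whose boundary vertices no three are
independent, has at most two end-blocks. -/
lemma NoCut.good (h : NoCut G W) (hUW : U ⊆ W) (hU : Conn G U)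
    (hb : ∀ a ∈ U, ∀ b ∈ U, ∀ c ∈ U, a ≠ b → a ≠ c → b ≠ c →
      (∃ x ∈ W, x ∉ U ∧ G.Adj a x) → (∃ x ∈ W, x ∉ U ∧ G.Adj b x) →
      (∃ x ∈ W, x ∉ U ∧ G.Adj c x) → G.Adj a b ∨ G.Adj a c ∨ G.Adj b c) : Good G U := by
  refine ⟨hU, ?_⟩
  intro E₁ h₁ E₂ h₂ E₃ h₃ n₁ n₂ n₃ v₁ v₂ v₃ b₁ b₂ b₃ a₁₂ a₁₃ a₂₃
  -- An end-piece of `U` without neighbours in `W \ U` is an end-piece of `W`, hence all of `W`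
  -- except possibly `v`. A set separated from it is then `{v}`, so it has no neighbour in `U` at
  -- all, against connectivity.
  have key : ∀ E ⊆ U, ∀ F ⊆ U, E.Nonempty → F.Nonempty → Apart G E F → ∀ v, Bdry G U E v →
      ∃ e ∈ E, ∃ x ∈ W, x ∉ U ∧ G.Adj e x := by
    intro E hE F hF hEne hFne hEF v hv
    by_contra! hcon
    have h1 := h.2 E (hE.trans hUW) hEne v (fun e he u hu huE heu =>
      hv e he u (by_contra fun huU => hcon e he u hu huU heu) huE heu)
    obtain ⟨f, hf⟩ := hFne
    obtain ⟨e, he⟩ := hEne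
    have hfE : f ∉ E := fun hfE => (hEF f hfE f hf).1 rfl
    have hfv : f = v := by grind
    have := hU.2 E hE ⟨e, he⟩ (fun e he u hu heu => by
      by_contra huE
      have := hv e he u hu huE heu
      exact (hEF e he f hf).2 (by rw [hfv, ← this]; exact heu))
    grind
  obtain ⟨e₁, m₁, o₁⟩ := key E₁ h₁ E₂ h₂ n₁ n₂ a₁₂ v₁ b₁
  obtain ⟨e₂, m₂, o₂⟩ := key E₂ h₂ E₁ h₁ n₂ n₁ a₁₂.symm v₂ b₂
  obtain ⟨e₃, m₃, o₃⟩ := key E₃ h₃ E₁ h₁ n₃ n₁ a₁₃.symm v₃ b₃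
  have h12 := a₁₂ _ m₁ _ m₂
  have h13 := a₁₃ _ m₁ _ m₃
  have h23 := a₂₃ _ m₂ _ m₃
  have := hb e₁ (h₁ m₁) e₂ (h₂ m₂) e₃ (h₃ m₃) h12.1 h13.1 h23.1 o₁ o₂ o₃
  tauto

lemma Ended.symm (h : Ended G U S T) : Ended G U T S :=
  ⟨h.1, fun E hE hne hT hS => h.2 E hE hne hS hT⟩

/-- Pigeonhole: of three end-pieces, two meet the same clique, so they intersect or are joined by an
edge. -/
lemma Ended.good (h : Ended G U S T) (hS : Clique G S) (hT : Clique G T) : Good G U := by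
  refine ⟨h.1, ?_⟩
  intro E₁ h₁ E₂ h₂ E₃ h₃ n₁ n₂ n₃ v₁ v₂ v₃ b₁ b₂ b₃ a₁₂ a₁₃ a₂₃
  have key : ∀ E ⊆ U, E.Nonempty → ∀ v, Bdry G U E v → (∃ s ∈ S, s ∈ E) ∨ ∃ t ∈ T, t ∈ E := by
    intro E hE hne v hv
    by_contra! hcon
    exact h.2 E hE hne hcon.1 hcon.2 v hv
  have clash : ∀ R, Clique G R → ∀ E F, Apart G E F → (∃ s ∈ R, s ∈ E) → (∃ s ∈ R, s ∈ F) →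
      False := by
    rintro R hR E F hEF ⟨s, hs, hsE⟩ ⟨t, ht, htF⟩
    have := hEF s hsE t htF
    exact this.2 (hR s hs t ht this.1)
  have k₁ := key E₁ h₁ n₁ v₁ b₁
  have k₂ := key E₂ h₂ n₂ v₂ b₂
  have k₃ := key E₃ h₃ n₃ v₃ b₃
  have s₁₂ := clash S hS _ _ a₁₂
  have s₁₃ := clash S hS _ _ a₁₃
  have s₂₃ := clash S hS _ _ a₂₃
  have t₁₂ := clash T hT _ _ a₁₂
  have t₁₃ := clash T hT _ _ a₁₃
  have t₂₃ := clash T hT _ _ a₂₃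
  rcases k₁ with k₁ | k₁ <;> rcases k₂ with k₂ | k₂ <;> rcases k₃ with k₃ | k₃ <;>
    first
      | exact s₁₂ k₁ k₂
      | exact s₁₃ k₁ k₃
      | exact s₂₃ k₂ k₃
      | exact t₁₂ k₁ k₂
      | exact t₁₃ k₁ k₃
      | exact t₂₃ k₂ k₃

lemma Clique.singleton : Clique G {a} := by
  intro b hb c hc
  simp at hb hc
  grind

/-- The end moves from `a` to `p`: an end-piece containing `a` but not `p` has `p` as its only
boundary vertex, so it contains all of `U` and meets `T`. -/
lemma Ended.insert_vertex (h : Ended G U {a} T) (ha : a ∈ U) (hT : ∃ t ∈ T, t ∈ U) (hp : p ∉ U)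
    (hpa : G.Adj p a) : Ended G (insert p U) {p} T := by
  refine ⟨h.1.insert_vertex ha hpa, fun E hE hne hpE hTE v hv => ?_⟩
  have hpE : p ∉ E := hpE p (by simp)
  have hEU : E ⊆ U := by grind
  by_cases haE : a ∈ E
  · have hvp := hv a haE p (by simp) hpE hpa.symm
    have := h.1.2 E hEU hne (fun e he u hu heu => by
      by_contra huE
      have := hv e he u (by grind) huE heu
      grind)
    grind
  · exact h.2 E hEU hne (by simpa using haE) hTE v
      (fun e he u hu huE heu => hv e he u (by grind) huE heu)

lemma NoCut.ended (h : NoCut G U) (ha : a ∈ U) (hb : b ∈ U) (hab : a ≠ b) :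
    Ended G U {a} {b} := by
  refine ⟨h.conn, fun E hE hne haE hbE v hv => ?_⟩
  have := h.2 E hE hne v hv
  grind

lemma Conn.exists_adj (h : Conn G U) (hE : E ⊆ U) (hne : E.Nonempty) (hx : x ∈ U) (hxE : x ∉ E) :
    ∃ e ∈ E, ∃ u ∈ U, u ∉ E ∧ G.Adj e u := by
  by_contra! hcon
  have := h.2 E hE hne (fun e he u hu heu => by_contra fun huE => hcon e he u hu huE heu)
  exact hxE (this hx)

lemma NoCut.exists_adj (h : NoCut G U) (hE : E ⊆ U) (hne : E.Nonempty) (hx : x ∈ U) (hxE : x ∉ E)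
    (hxv : x ≠ v) : ∃ e ∈ E, ∃ u ∈ U, u ∉ E ∧ u ≠ v ∧ G.Adj e u := by
  by_contra! hcon
  have := h.2 E hE hne v (fun e he u hu huE heu => by_contra fun huv => hcon e he u hu huE huv heu)
  grind

/-- In a graph without cut vertices and with at least three vertices every vertex has a neighbour
different from a given vertex. -/
lemma NoCut.exists_adj_ne (h : NoCut G U) (hc : 3 ≤ U.card) (hx : x ∈ U) (v : V) :
    ∃ u ∈ U, u ≠ v ∧ G.Adj x u := by
  obtain ⟨w, hw, hwn⟩ := Finset.exists_mem_notMem_of_card_lt_card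
    (s := ({x, v} : Finset V)) (t := U) (lt_of_le_of_lt Finset.card_le_two (by omega))
  obtain ⟨e, he, u, hu, -, huv, heu⟩ := h.exists_adj (E := {x}) (x := w) (v := v) (by simpa) (by simp)
    hw (by grind) (by grind)
  exact ⟨u, hu, huv, by grind⟩

/-! ### Cut vertices -/

lemma exists_isCut (h : Conn G U) (hn : ¬ NoCut G U) : ∃ A c B, IsCut G U A c B := by
  have : ∃ E ⊆ U, E.Nonempty ∧ ∃ v, Bdry G U E v ∧ ¬ U ⊆ insert v E := by
    by_contra! hcon
    exact hn ⟨h.1, fun E hE hne v hv => hcon E hE hne v hv⟩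
  obtain ⟨E, hE, hne, v, hv, hU⟩ := this
  obtain ⟨w, hw, hwn⟩ := Finset.not_subset.1 hU
  -- Connectivity gives an edge leaving `E`. It ends at `v`, which therefore lies in `U` and outside
  -- `E`.
  obtain ⟨e, he, u, hu, huE, heu⟩ := h.exists_adj hE hne hw (by grind)
  have hvu := hv e he u hu huE heu
  subst hvu
  refine ⟨E, u, (U \ E).erase u, ?_, hne, ⟨w, by grind⟩, huE, by simp, fun e he f hf => ⟨?_, ?_⟩⟩
  · ext; grind
  · grind
  · intro hef
    have := hv e he f (by grind) (by grind) hef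
    grind

lemma Conn.cut_adj (h : Conn G U) (hcut : IsCut G U A c B) : ∃ a ∈ A, G.Adj c a := by
  obtain ⟨b, hb⟩ := hcut.right
  have hUe := hcut.eq
  obtain ⟨e, he, u, hu, huE, heu⟩ := h.exists_adj (E := A) (x := c) (by grind) hcut.left (by grind)
    hcut.notMem_left
  have := hcut.apart e he u
  have := heu.symm
  grind

/-- Two nonadjacent neighbours of `c` in `A` would form a claw together with a neighbour of `c` in
`B`. -/
lemma Conn.cut_clique (h : Conn G U) (hG : NoClaw G) (hcut : IsCut G U A c B) :
    ∀ a ∈ A, ∀ a' ∈ A, G.Adj c a → G.Adj c a' → a ≠ a' → G.Adj a a' := by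
  intro a ha a' ha' hca hca' hne
  obtain ⟨b, hb, hcb⟩ := h.cut_adj hcut.symm
  have h1 := hcut.apart a ha b hb
  have h2 := hcut.apart a' ha' b hb
  have := hG c a a' b hca hca' hcb hne h1.1 h2.1
  tauto

lemma IsCut.bdry (hcut : IsCut G U A c B) : Bdry G U A c := by
  intro e he u hu huA heu
  have := hcut.eq
  have := hcut.apart e he u
  grind

/-- A side of a cut vertex, together with the cut vertex and one of its neighbours on the other
side. -/
lemma Good.cut_insert (h : Good G U) (hcut : IsCut G U A c B) (hb : b ∈ B)
    (hcb : G.Adj c b) : Good G (insert b (insert c A)) := by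
  have hU := hcut.eq
  have hBA := hcut.symm.bdry
  have hAB := hcut.bdry
  have hap := hcut.apart
  have hcA := hcut.notMem_left
  have hcB := hcut.notMem_right
  have hbA : b ∉ A := fun hbA => (hap b hbA b hb).1 rfl
  have hac := G.adj_comm
  have hnb : ∀ u ∈ insert b (insert c A), G.Adj b u → u = c := by
    intro u hu hbu
    have := hBA b hb u
    have := hbu.ne
    grind [Apart]
  refine ⟨⟨by simp, fun E hE hne hc => ?_⟩, ?_⟩
  · by_cases hcE : c ∈ E
    · have hbE := hc c hcE b (by simp) hcb
      have := h.1.2 (E ∪ B) (by grind) ⟨c, by grind⟩ (fun e he u hu heu => by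
        have := hc e
        have := hBA e
        grind)
      have hdis : ∀ a ∈ A, a ∉ B := fun a ha ha' => (hap a ha a ha').1 rfl
      intro w hw
      have h1 := @this w
      have h2 := hdis w
      rw [hU] at h1
      clear hap hAB hBA hnb hc
      grind
    · have hbE : b ∉ E := fun hbE => hcE (hc b hbE c (by simp) hcb.symm)
      have := h.1.2 E (by grind) hne (fun e he u hu heu => by
        have := hc e he u
        have := hAB e
        grind)
      grind
  -- Here `b` represents all of `B`: an end-piece meeting `{c, b}` is enlarged by the whole of `B`,
  -- and any other one is kept.
  · have key : ∀ E ⊆ insert b (insert c A), ∀ v, Bdry G (insert b (insert c A)) E v →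
        ∃ F ⊆ U, E ⊆ F ∧ Bdry G U F v ∧ F ⊆ E ∪ B ∧ (c ∈ E ∨ b ∈ E ∨ F = E) := by
      intro E hE v hv
      by_cases hcE : c ∈ E ∨ b ∈ E
      · refine ⟨E ∪ B, by grind, by grind, ?_, by grind, by tauto⟩
        intro e he u hu huE heu
        by_cases hcE' : c ∈ E
        · have := hv e
          have := hBA e
          grind
        · have := hv b (by tauto) c (by simp) hcE' hcb.symm
          have := hv e
          have := hBA e
          grind
      · refine ⟨E, by grind, by grind, ?_, by grind, by tauto⟩
        intro e he u hu huE heu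
        have := hAB e
        have := hv e
        grind
    have ap : ∀ E ⊆ insert b (insert c A), ∀ F ⊆ insert b (insert c A), ∀ E' F', Apart G E F →
        E' ⊆ E ∪ B → (c ∈ E ∨ b ∈ E ∨ E' = E) → F' ⊆ F ∪ B → (c ∈ F ∨ b ∈ F ∨ F' = F) →
        Apart G E' F' := by
      intro E hE F hF E' F' hEF h1 h2 h3 h4 e he f hf
      have := hEF c
      have := hEF b
      have := hEF e
      have := hap e
      have := hap f
      grind
    intro E₁ h₁ E₂ h₂ E₃ h₃ n₁ n₂ n₃ v₁ v₂ v₃ b₁ b₂ b₃ a₁₂ a₁₃ a₂₃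
    obtain ⟨F₁, f₁, i₁, g₁, j₁, k₁⟩ := key E₁ h₁ v₁ b₁
    obtain ⟨F₂, f₂, i₂, g₂, j₂, k₂⟩ := key E₂ h₂ v₂ b₂
    obtain ⟨F₃, f₃, i₃, g₃, j₃, k₃⟩ := key E₃ h₃ v₃ b₃
    exact h.2 F₁ f₁ F₂ f₂ F₃ f₃ (n₁.mono i₁) (n₂.mono i₂) (n₃.mono i₃) v₁ v₂ v₃ g₁ g₂ g₃
      (ap E₁ h₁ E₂ h₂ F₁ F₂ a₁₂ j₁ k₁ j₂ k₂) (ap E₁ h₁ E₃ h₃ F₁ F₃ a₁₃ j₁ k₁ j₃ k₃)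
      (ap E₂ h₂ E₃ h₃ F₂ F₃ a₂₃ j₂ k₂ j₃ k₃)

/-- The vertex `b` of `Good.cut_insert` has `c` as its only neighbour there, so `Good.erase` removes
it. -/
lemma Good.cut_insert_vertex (h : Good G U) (hcut : IsCut G U A c B) : Good G (insert c A) := by
  obtain ⟨b, hb, hcb⟩ := h.1.cut_adj hcut.symm
  have hbA : b ∉ A := fun hbA => (hcut.apart b hbA b hb).1 rfl
  have h1 := (h.cut_insert hcut hb hcb)
  have hap := hcut.apart
  have := h1.erase (v := b) (by simp) (fun x hx y hy hbx hby hxy => by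
    have h3 : ∀ u ∈ insert b (insert c A), G.Adj b u → u = c := by
      intro u hu hbu
      have := hbu.ne
      have := hap u
      have := hbu.symm
      grind
    grind) ⟨c, by have := hcb.ne; grind⟩
  rwa [Finset.erase_insert] at this
  have := hcb.ne
  grind

/-- By claw-freeness the neighbours of `c` in `A` form a clique, so `c` can be removed as well. -/
lemma Good.cut_side (h : Good G U) (hG : NoClaw G) (hcut : IsCut G U A c B) : Good G A := by
  have := (h.cut_insert_vertex hcut).erase (v := c) (by simp) (fun x hx y hy hcx hcy hxy => by
    have := h.1.cut_clique hG hcut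
    have := hcx.ne
    have := hcy.ne
    grind) (by simpa [Finset.erase_insert hcut.notMem_left] using hcut.left)
  rwa [Finset.erase_insert hcut.notMem_left] at this

lemma IsCut.card (hcut : IsCut G U A c B) : U.card = A.card + B.card + 1 := by
  have hd : Disjoint A B := Finset.disjoint_left.2 fun a ha hb => (hcut.apart a ha a hb).1 rfl
  rw [hcut.eq, Finset.card_insert_of_notMem, Finset.card_union_of_disjoint hd]
  have := hcut.notMem_left
  have := hcut.notMem_right
  grind

/-! ### Tilings by paths with three vertices -/

lemma Tiles.union (hX : Tiles G X) (hY : Tiles G Y) (hd : Disjoint X Y) : Tiles G (X ∪ Y) := by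
  induction hX with
  | empty => simpa
  | @step U a b c hU hab hbc hac ha hb hc ih =>
    have hd' : ∀ x ∈ insert a (insert b (insert c U)), x ∉ Y := fun x hx => Finset.disjoint_left.1 hd hx
    have := Tiles.step (ih (Finset.disjoint_left.2 fun x hx => hd' x (by grind))) hab hbc hac
      (by grind) (by grind) (by grind)
    simpa using this

lemma Tiles.path (hab : G.Adj a b) (hbc : G.Adj b c) (hac : a ≠ c) : Tiles G {a, b, c} := by
  simpa using Tiles.step Tiles.empty hab hbc hac (by simp) (by simp) (by simp)

/-- Tilings of disjoint sets can be put together. -/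
lemma Tiles.of_eq_union (hX : Tiles G X) (hY : Tiles G Y) (hd : ∀ x ∈ X, x ∉ Y)
    (hU : ∀ x, x ∈ U ↔ x ∈ X ∨ x ∈ Y) : Tiles G U := by
  have : U = X ∪ Y := by ext x; simp [hU]
  rw [this]
  exact hX.union hY (Finset.disjoint_left.2 fun x hx => hd x hx)

lemma Tiles.exists_path (hX : Tiles G X) (hp : p ∈ X) : ∃ a b c, G.Adj a b ∧ G.Adj b c ∧ a ≠ c ∧
    a ∈ X ∧ b ∈ X ∧ c ∈ X ∧ (p = a ∨ p = b ∨ p = c) ∧ Tiles G (X \ {a, b, c}) := by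
  induction hX with
  | empty => simp at hp
  | @step U a b c hU hab hbc hac ha hb hc ih =>
    by_cases hpU : p ∈ U
    · obtain ⟨a', b', c', h1, h2, h3, h4, h5, h6, h7, h8⟩ := ih hpU
      refine ⟨a', b', c', h1, h2, h3, by grind, by grind, by grind, h7, ?_⟩
      have := Tiles.step h8 hab hbc hac (by grind) (by grind) (by grind)
      have hne : ∀ u ∈ U, u ≠ a ∧ u ≠ b ∧ u ≠ c := by grind
      have := hne a' h4
      have := hne b' h5
      have := hne c' h6
      have heq : insert a (insert b (insert c U)) \ {a', b', c'} =
          insert a (insert b (insert c (U \ {a', b', c'}))) := by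
        clear h7 ih
        ext u
        simp only [Finset.mem_sdiff, Finset.mem_insert, Finset.mem_singleton]
        grind
      rwa [heq]
    · refine ⟨a, b, c, hab, hbc, hac, by grind, by grind, by grind, by grind, ?_⟩
      convert hU using 1
      have := hab.ne
      have := hbc.ne
      ext; grind

/-- A pendant vertex `p` at `d` lies in a path `p`, `d`, `a`. -/
lemma Tiles.exists_pendant (hX : Tiles G X) (hp : p ∈ X) (hpd : ∀ u ∈ X, G.Adj p u → u = d) :
    ∃ a ∈ X, a ≠ p ∧ a ≠ d ∧ d ∈ X ∧ d ≠ p ∧ G.Adj d a ∧ Tiles G (X \ {p, d, a}) := by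
  obtain ⟨a, b, c, hab, hbc, hac, ha, hb, hc, hp', hT⟩ := hX.exists_path hp
  have n1 := hab.ne
  have n2 := hbc.ne
  rcases hp' with rfl | rfl | rfl
  · obtain rfl := hpd b hb hab
    exact ⟨c, hc, by grind, by grind, hb, by grind, hbc, hT⟩
  · have h1 := hpd a ha hab.symm
    have h2 := hpd c hc hbc
    grind
  · obtain rfl := hpd b hb hbc.symm
    refine ⟨a, ha, by grind, by grind, hb, by grind, hab.symm, ?_⟩
    convert hT using 2
    ext; grind


/-! ### The inductive step at a cut vertex -/

lemma IsCut.mem (hcut : IsCut G U A c B) (x : V) : x ∈ U ↔ x = c ∨ x ∈ A ∨ x ∈ B := by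
  rw [hcut.eq]; simp

lemma IsCut.disjoint (hcut : IsCut G U A c B) : ∀ x ∈ A, x ∉ B :=
  fun x hx hx' => (hcut.apart x hx x hx').1 rfl

/-- Tile `A` together with `c` and a neighbour `b` of `c` in `B`. The pendant vertex `b` forces a
path `b`, `c`, `a`, and removing it leaves `A - a`. The bound on `B` makes this set smaller than
`U`. -/
lemma Good.cut_tiles_erase (h : Good G U) (hcut : IsCut G U A c B) (hB : 2 ≤ B.card)
    (hA : A.card % 3 = 1)
    (ih : ∀ W : Finset V, W.card < U.card → Good G W → 3 ∣ W.card → Tiles G W) :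
    ∃ a ∈ A, G.Adj c a ∧ Tiles G (A.erase a) := by
  obtain ⟨b, hb, hcb⟩ := h.1.cut_adj hcut.symm
  have hcA := hcut.notMem_left
  have hbA : b ∉ A := fun hbA => hcut.disjoint b hbA hb
  have hbc := hcb.ne
  have hcard : (insert b (insert c A)).card = A.card + 2 := by
    rw [Finset.card_insert_of_notMem (by grind), Finset.card_insert_of_notMem hcA]
  have hU := hcut.card
  obtain ⟨a, ha, hab, hac, -, -, hca, hT⟩ := (ih _ (by omega) (h.cut_insert hcut hb hcb)
    (by omega)).exists_pendant (p := b) (d := c) (by simp) (fun u hu hbu => by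
      have := hcut.apart u
      have := hbu.ne
      have := hbu.symm
      grind)
  refine ⟨a, by grind, hca, ?_⟩
  convert hT using 1
  ext; grind

/-- Both `A` and `B` with `c` added have order divisible by three, and they are tiled separately. -/
lemma Good.tiles_of_cut_left (h : Good G U) (hG : NoClaw G) (hcut : IsCut G U A c B)
    (h3 : 3 ∣ U.card) (hA : A.card % 3 = 0)
    (ih : ∀ W : Finset V, W.card < U.card → Good G W → 3 ∣ W.card → Tiles G W) : Tiles G U := by
  have hU := hcut.card
  have hcB := hcut.notMem_right
  have hcard : (insert c B).card = B.card + 1 := Finset.card_insert_of_notMem hcB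
  have h1 := hcut.left.card_pos
  have h2 := hcut.right.card_pos
  have := hcut.disjoint
  have := hcut.notMem_left
  exact (ih A (by omega) (h.cut_side hG hcut) (by omega)).of_eq_union
    (ih _ (by omega) (h.cut_insert_vertex hcut.symm) (by omega)) (by grind)
    (fun x => by rw [hcut.mem]; grind)

/-- The inductive step at a cut vertex, unless a side is a single vertex. -/
lemma Good.tiles_of_cut (h : Good G U) (hG : NoClaw G) (hcut : IsCut G U A c B)
    (h3 : 3 ∣ U.card) (hside : A.card % 3 = 1 → 2 ≤ A.card ∧ 2 ≤ B.card)
    (ih : ∀ W : Finset V, W.card < U.card → Good G W → 3 ∣ W.card → Tiles G W) : Tiles G U := by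
  have hU := hcut.card
  have : A.card % 3 = 0 ∨ A.card % 3 = 1 ∨ A.card % 3 = 2 := by omega
  rcases this with h0 | h1 | h2
  · exact h.tiles_of_cut_left hG hcut h3 h0 ih
  -- Both sides have order one modulo three. The path `a`, `c`, `b` takes one vertex from each.
  · obtain ⟨a, ha, hca, hTa⟩ := h.cut_tiles_erase hcut (hside h1).2 h1 ih
    obtain ⟨b, hb, hcb, hTb⟩ := h.cut_tiles_erase hcut.symm (hside h1).1 (by omega) ih
    have := hcut.disjoint
    have := hcut.notMem_left
    have := hcut.notMem_right
    refine ((Tiles.path hca.symm hcb (by grind)).of_eq_union (U := insert c (insert b A)) hTa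
      (by grind) (by grind)).of_eq_union hTb (by grind) (fun x => by rw [hcut.mem]; grind)
  · exact h.tiles_of_cut_left hG hcut.symm h3 (by omega) ih

/-! ### The inductive step without cut vertices -/

/-- The boundary vertices of `U - y` are neighbours of `y`, and no three of these are independent,
so `NoCut.good` applies. -/
lemma NoCut.good_erase_cut (h : NoCut G U) (hG : NoClaw G) (hy : y ∈ U)
    (hne : (U.erase y).Nonempty) : Good G (U.erase y) := by
  refine h.good (by grind) (h.conn_erase hne) ?_
  have key : ∀ a, (∃ x ∈ U, x ∉ U.erase y ∧ G.Adj a x) → G.Adj y a := by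
    rintro a ⟨x, hx, hxy, hax⟩
    have : x = y := by grind
    exact this ▸ hax.symm
  intro a ha b hb c hc hab hac hbc h1 h2 h3
  exact hG y a b c (key a h1) (key b h2) (key c h3) hab hac hbc

lemma NoCut.conn_cut_insert (h : NoCut G U) (hG : NoClaw G) (hy : y ∈ U)
    (hcut : IsCut G (U.erase y) A c B) : Conn G (insert y A) := by
  have hg := h.good_erase_cut hG hy ⟨c, by rw [hcut.mem]; simp⟩
  have hmem := hcut.mem
  obtain ⟨e, he, u, hu, huA, huc, heu⟩ := h.exists_adj (E := A) (x := y) (v := c)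
    (fun x hx => by have := hmem x; grind) hcut.left hy (by have := hmem y; grind)
    (by have := hmem c; grind)
  have hu : u = y := by
    have := hcut.apart e he u
    have := hmem u
    grind
  exact (hg.cut_side hG hcut).1.insert_vertex he (hu ▸ heu.symm)

/-- As `c` alone does not separate `U`, the vertex `y` also has a neighbour in `B`, and a claw at
`y` is excluded. -/
lemma NoCut.cut_clique (h : NoCut G U) (hG : NoClaw G) (hy : y ∈ U)
    (hcut : IsCut G (U.erase y) A c B) :
    ∀ a ∈ A, ∀ a' ∈ A, G.Adj y a → G.Adj y a' → a ≠ a' → G.Adj a a' := by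
  have hmem := hcut.mem
  obtain ⟨b, hb, u, hu, huA, huc, hbu⟩ := h.exists_adj (E := B) (x := y) (v := c)
    (fun x hx => by have := hmem x; grind) hcut.right hy (by have := hmem y; grind)
    (by have := hmem c; grind)
  have hu : u = y := by
    have := hcut.symm.apart b hb u
    have := hmem u
    grind
  subst hu
  intro a ha a' ha' h1 h2 hne
  have h3 := hcut.apart a ha b hb
  have h4 := hcut.apart a' ha' b hb
  have := hG u a a' b h1 h2 hbu.symm hne h3.1 h4.1
  tauto

/-- Tile `A` and its complement. The complement has only the boundary vertices `c` and `y`, too few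
for three end-pieces. -/
lemma NoCut.tiles_of_erase_cut_left (h : NoCut G U) (hG : NoClaw G) (h3 : 3 ∣ U.card) (hy : y ∈ U)
    (hcut : IsCut G (U.erase y) A c B) (hA : A.card % 3 = 0)
    (ih : ∀ W : Finset V, W.card < U.card → Good G W → 3 ∣ W.card → Tiles G W) : Tiles G U := by
  have hg := h.good_erase_cut hG hy ⟨c, by rw [hcut.mem]; simp⟩
  have hmem := hcut.mem
  have hyA : y ∉ A := by have := hmem y; grind
  have hyB : y ∉ B := by have := hmem y; grind
  have hyc : y ≠ c := by have := hmem c; grind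
  have hcB := hcut.notMem_right
  have hcA := hcut.notMem_left
  have hAB := hcut.disjoint
  have hcard := hcut.card
  rw [Finset.card_erase_of_mem hy] at hcard
  have hc2 : (insert c (insert y B)).card = B.card + 2 := by
    rw [Finset.card_insert_of_notMem (by grind), Finset.card_insert_of_notMem hyB]
  have h1 := hcut.left.card_pos
  obtain ⟨b, hb, hcb⟩ := hg.1.cut_adj hcut.symm
  have hgood : Good G (insert c (insert y B)) := by
    refine h.good (fun x hx => by have := hmem x; grind)
      ((h.conn_cut_insert hG hy hcut.symm).insert_vertex (a := b) (by grind) hcb) ?_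
    have key : ∀ x ∈ insert c (insert y B), (∃ u ∈ U, u ∉ insert c (insert y B) ∧ G.Adj x u) →
        x = c ∨ x = y := by
      rintro x hx ⟨u, hu, hu', hxu⟩
      have := hcut.symm.apart x
      have := hmem u
      grind
    intro a ha b hb c hc hab hac hbc h1 h2 h3
    have := key a ha h1
    have := key b hb h2
    have := key c hc h3
    grind
  exact (ih A (by omega) (hg.cut_side hG hcut) (by omega)).of_eq_union
    (ih _ (by omega) hgood (by omega)) (by grind) (fun x => by have := hmem x; grind)

/-- The inductive step for a graph without cut vertices that has a vertex cut of size two. -/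
lemma NoCut.tiles_of_erase_cut (h : NoCut G U) (hG : NoClaw G) (h3 : 3 ∣ U.card) (hy : y ∈ U)
    (hcut : IsCut G (U.erase y) A c B)
    (ih : ∀ W : Finset V, W.card < U.card → Good G W → 3 ∣ W.card → Tiles G W) : Tiles G U := by
  have hg := h.good_erase_cut hG hy ⟨c, by rw [hcut.mem]; simp⟩
  have hcard := hcut.card
  rw [Finset.card_erase_of_mem hy] at hcard
  -- The orders of `A` and `B` sum to one modulo three. In the last case `c` joins `A` and `y` joins
  -- `B`.
  have : A.card % 3 = 0 ∨ B.card % 3 = 0 ∨ (A.card % 3 = 2 ∧ B.card % 3 = 2) := by omega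
  rcases this with h0 | h0 | ⟨hA, hB⟩
  · exact h.tiles_of_erase_cut_left hG h3 hy hcut h0 ih
  · exact h.tiles_of_erase_cut_left hG h3 hy hcut.symm h0 ih
  have hmem := hcut.mem
  have hyA : y ∉ A := by have := hmem y; grind
  have hyB : y ∉ B := by have := hmem y; grind
  have hyc : y ≠ c := by have := hmem c; grind
  have hcB := hcut.notMem_right
  have hcA := hcut.notMem_left
  have hAB := hcut.disjoint
  have h1 : (insert c A).card = A.card + 1 := Finset.card_insert_of_notMem hcA
  have h2 : (insert y B).card = B.card + 1 := Finset.card_insert_of_notMem hyB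
  -- The boundary vertices are `y` and the neighbours of `c` in `B`, which form a clique, so no
  -- three are independent.
  have hgood : Good G (insert y B) := by
    refine h.good (fun x hx => by have := hmem x; grind) (h.conn_cut_insert hG hy hcut.symm) ?_
    have key : ∀ x ∈ insert y B, (∃ u ∈ U, u ∉ insert y B ∧ G.Adj x u) →
        x = y ∨ (x ∈ B ∧ G.Adj c x) := by
      rintro x hx ⟨u, hu, hu', hxu⟩
      have := hcut.symm.apart x
      have := hmem u
      have := hxu.symm
      grind
    have hcl := hg.1.cut_clique hG hcut.symm
    intro a ha b hb c hc hab hac hbc h1 h2 h3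
    have := key a ha h1
    have := key b hb h2
    have := key c hc h3
    grind
  exact (ih _ (by omega) (hg.cut_insert_vertex hcut) (by omega)).of_eq_union
    (ih _ (by omega) hgood (by omega)) (by grind) (fun x => by have := hmem x; grind)

/-- The separator is `{x, y, d}`. The edge `xy` stays with `B`, while `d` joins `B` or `A` according
to the residue of `A`. The boundary vertices of the part containing `B` are `x`, `y` and either `d`
or the clique of neighbours of `d` in `B`. In both cases `xy` being an edge prevents three
independent ones. -/
lemma NoCut.tiles_of_cut_pair_left (h : NoCut G U) (hG : NoClaw G) (h3 : 3 ∣ U.card) (hx : x ∈ U)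
    (hy : y ∈ U) (hxy : G.Adj x y) (hny : NoCut G (U.erase y))
    (hcut : IsCut G ((U.erase y).erase x) A d B) (hA : A.card % 3 = 0 ∨ A.card % 3 = 2)
    (hB : (A.card + B.card) % 3 = 0)
    (ih : ∀ W : Finset V, W.card < U.card → Good G W → 3 ∣ W.card → Tiles G W) : Tiles G U := by
  have hne := hxy.ne
  have hmem := hcut.mem
  have hcutx : IsCut G ((U.erase x).erase y) A d B := by
    rwa [Finset.erase_right_comm]
  have hxy' : x ∈ U.erase y := by grind
  have hg := hny.good_erase_cut hG hxy' ⟨d, by rw [hmem]; simp⟩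
  have hxA : x ∉ A := by have := hmem x; grind
  have hxB : x ∉ B := by have := hmem x; grind
  have hyA : y ∉ A := by have := hmem y; grind
  have hyB : y ∉ B := by have := hmem y; grind
  have hxd : x ≠ d := by have := hmem d; grind
  have hyd : y ≠ d := by have := hmem d; grind
  have hdA := hcut.notMem_left
  have hdB := hcut.notMem_right
  have hAB := hcut.disjoint
  have hcard := hcut.card
  rw [Finset.card_erase_of_mem hxy', Finset.card_erase_of_mem hy] at hcard
  have hp1 := hcut.left.card_pos
  have hp2 := hcut.right.card_pos
  have hcB : Conn G (insert y (insert x B)) :=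
    (hny.conn_cut_insert hG hxy' hcut.symm).insert_vertex (a := x) (by grind) hxy.symm
  rcases hA with hA | hA
  · have hgood : Good G (insert d (insert y (insert x B))) := by
      obtain ⟨b, hb, hdb⟩ := hg.1.cut_adj hcut.symm
      refine h.good (fun u hu => by have := hmem u; grind)
        (hcB.insert_vertex (a := b) (by grind) hdb) ?_
      have key : ∀ u ∈ insert d (insert y (insert x B)),
          (∃ w ∈ U, w ∉ insert d (insert y (insert x B)) ∧ G.Adj u w) →
          u = d ∨ u = x ∨ u = y := by
        rintro u hu ⟨w, hw, hw', huw⟩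
        have := hcut.symm.apart u
        have := hmem w
        grind
      have := hxy.symm
      intro a ha b hb c hc hab hac hbc h1 h2 h3
      have := key a ha h1
      have := key b hb h2
      have := key c hc h3
      grind
    have hc2 : (insert d (insert y (insert x B))).card = B.card + 3 := by
      rw [Finset.card_insert_of_notMem (by grind), Finset.card_insert_of_notMem (by grind),
        Finset.card_insert_of_notMem hxB]
    exact (ih A (by omega) (hg.cut_side hG hcut) (by omega)).of_eq_union
      (ih _ (by omega) hgood (by omega)) (by grind) (fun x => by have := hmem x; grind)
  · have hgood : Good G (insert y (insert x B)) := by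
      refine h.good (fun u hu => by have := hmem u; grind) hcB ?_
      have key : ∀ u ∈ insert y (insert x B),
          (∃ w ∈ U, w ∉ insert y (insert x B) ∧ G.Adj u w) →
          u = x ∨ u = y ∨ (u ∈ B ∧ G.Adj d u) := by
        rintro u hu ⟨w, hw, hw', huw⟩
        have := hcut.symm.apart u
        have := hmem w
        have := huw.symm
        grind
      have := hxy.symm
      have hcl := hg.1.cut_clique hG hcut.symm
      intro a ha b hb c hc hab hac hbc h1 h2 h3
      have := key a ha h1
      have := key b hb h2
      have := key c hc h3
      grind
    have hc2 : (insert y (insert x B)).card = B.card + 2 := by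
      rw [Finset.card_insert_of_notMem (by grind), Finset.card_insert_of_notMem hxB]
    have hc1 : (insert d A).card = A.card + 1 := Finset.card_insert_of_notMem hdA
    exact (ih _ (by omega) (hg.cut_insert_vertex hcut) (by omega)).of_eq_union
      (ih _ (by omega) hgood (by omega)) (by grind) (fun x => by have := hmem x; grind)

/-- The inductive step for a graph without cut vertices. -/
lemma NoCut.tiles (h : NoCut G U) (hG : NoClaw G) (h3 : 3 ∣ U.card)
    (ih : ∀ W : Finset V, W.card < U.card → Good G W → 3 ∣ W.card → Tiles G W) : Tiles G U := by
  have hpos := h.1.card_pos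
  obtain ⟨y, hy⟩ := h.1
  obtain ⟨x, hx, -, hyx⟩ := h.exists_adj_ne (by omega) hy y
  by_cases h3' : U.card = 3
  · obtain ⟨z, hz, hzx, hyz⟩ := h.exists_adj_ne (by omega) hy x
    have : U = {x, y, z} := by
      symm
      apply Finset.eq_of_subset_of_card_le
      · grind
      · rw [h3', Finset.card_eq_three.2 ⟨x, y, z, hyx.ne.symm, hzx.symm, hyz.ne, rfl⟩]
    rw [this]
    exact Tiles.path hyx.symm hyz hzx.symm
  have hcy := Finset.card_erase_of_mem hy
  by_cases hex : ∃ w ∈ U, ¬ NoCut G (U.erase w)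
  · obtain ⟨w, hw, hnw⟩ := hex
    have hcw := Finset.card_erase_of_mem hw
    have hne : (U.erase w).Nonempty := Finset.card_pos.1 (by omega)
    obtain ⟨A, c, B, hcut⟩ := exists_isCut (h.conn_erase hne) hnw
    exact h.tiles_of_erase_cut hG h3 hw hcut ih
  push Not at hex
  have hny := hex y hy
  have hxy' : x ∈ U.erase y := by have := hyx.ne; grind
  have hcx := Finset.card_erase_of_mem hxy'
  have hne : ((U.erase y).erase x).Nonempty := Finset.card_pos.1 (by omega)
  -- If `U - y - x` has no cut vertex, remove a path `y`, `x`, `z`: deleting the further vertex `z`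
  -- leaves at most two end-blocks.
  by_cases hnxy : NoCut G ((U.erase y).erase x)
  · obtain ⟨z, hz, hzy, hxz⟩ := h.exists_adj_ne (by omega) hx y
    have := hxz.ne
    have hz' : z ∈ (U.erase y).erase x := by grind
    have hcz := Finset.card_erase_of_mem hz'
    have hgood := hnxy.good_erase_cut hG hz' (Finset.card_pos.1 (by omega))
    exact (ih _ (by omega) hgood (by omega)).of_eq_union (Tiles.path hyx hxz hzy.symm)
      (by grind) (by grind)
  · obtain ⟨A, d, B, hcut⟩ := exists_isCut (hny.conn_erase hne) hnxy
    have hcard := hcut.card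
    -- The orders of the sides sum to zero modulo three, so interchanging them turns residue one of
    -- `A` into residue two.
    by_cases hA : A.card % 3 = 1
    · exact h.tiles_of_cut_pair_left hG h3 hx hy hyx.symm hny hcut.symm (by omega) (by omega) ih
    · exact h.tiles_of_cut_pair_left hG h3 hx hy hyx.symm hny hcut (by omega) (by omega) ih

/-! ### Arms attached to a block with a pendant vertex -/

/-- The ways in which `L` can be tiled when it is attached to the rest of the graph at `d`. -/
def Arm (G : SimpleGraph V) (L : Finset V) (d : V) : Prop :=
  (L.card % 3 = 0 → Tiles G L) ∧ (L.card % 3 = 2 → Tiles G (insert d L)) ∧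
    (L.card % 3 = 1 → ∃ a ∈ L, G.Adj d a ∧ Tiles G (L.erase a))

/-- Zero, one or two of the vertices `d`, `y` are added to reach a multiple of three. In the last
case the pendant vertex `y` forces a path `y`, `d`, `a`, and removing it leaves `L - a`. -/
lemma Arm.of_good {n : ℕ} {L : Finset V} (h0 : Good G L) (h1 : Good G (insert d L))
    (h2 : Good G (insert y (insert d L))) (hd : d ∉ L) (hy : y ∉ insert d L)
    (hyd : ∀ u ∈ insert d L, G.Adj y u → u = d) (hn : L.card + 2 < n)
    (ih : ∀ W : Finset V, W.card < n → Good G W → 3 ∣ W.card → Tiles G W) : Arm G L d := by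
  have c1 : (insert d L).card = L.card + 1 := Finset.card_insert_of_notMem hd
  have c2 : (insert y (insert d L)).card = L.card + 2 := by
    rw [Finset.card_insert_of_notMem hy, c1]
  refine ⟨fun h => ih _ (by omega) h0 (by omega), fun h => ih _ (by omega) h1 (by omega),
    fun h => ?_⟩
  obtain ⟨a, ha, hay, had, -, -, hda, hT⟩ := (ih _ (by omega) h2 (by omega)).exists_pendant
    (p := y) (d := d) (by simp) (fun u hu hyu => hyd u (by have := hyu.ne; grind) hyu)
  refine ⟨a, by grind, hda, ?_⟩
  convert hT using 1
  ext; grind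

/-- A part `D` without cut vertices, with a pendant vertex `p` at `c` and an arm at `d`. -/
lemma Arm.tiles_union {n : ℕ} {R : Finset V} {e : V} (hR : Arm G R d) (hD : NoCut G D)
    (hc : c ∈ D) (hd : d ∈ D) (hcd : c ≠ d)
    (hcl : ∀ a ∈ D, ∀ b ∈ D, G.Adj d a → G.Adj d b → a ≠ b → G.Adj a b)
    (hp : p ∉ D) (hpc : G.Adj p c) (he : e ∉ insert p D) (hed : G.Adj e d)
    (heD : ∀ u ∈ insert p D, G.Adj e u → u = d) (hdis : ∀ x ∈ R, x ∉ insert p D)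
    (h3 : 3 ∣ R.card + D.card + 1) (hn : D.card + 2 < n)
    (ih : ∀ W : Finset V, W.card < n → Good G W → 3 ∣ W.card → Tiles G W) :
    Tiles G (R ∪ insert p D) := by
  have c1 : (insert p D).card = D.card + 1 := Finset.card_insert_of_notMem hp
  have hend := (hD.ended hc hd hcd).insert_vertex hc ⟨d, by simp, hd⟩ hp hpc
  have : R.card % 3 = 0 ∨ R.card % 3 = 1 ∨ R.card % 3 = 2 := by omega
  rcases this with h | h | h
  · exact (hR.1 h).union (ih _ (by omega) (hend.good Clique.singleton Clique.singleton)
      (by omega)) (Finset.disjoint_left.2 hdis)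
  -- A pendant vertex `e` at `d` stands in for the arm. Its path `e`, `d`, `y` is replaced by `a`,
  -- `d`, `y`, with `a` the vertex left over in the arm.
  · have hend2 := hend.symm.insert_vertex (by grind) ⟨p, by simp, by simp⟩ he hed
    have c2 : (insert e (insert p D)).card = D.card + 2 := by
      rw [Finset.card_insert_of_notMem he, c1]
    obtain ⟨y, hy, hye, hyd, -, -, hdy, hT⟩ :=
      (ih _ (by omega) (hend2.good Clique.singleton Clique.singleton) (by omega)).exists_pendant
        (p := e) (d := d) (by simp) (fun u hu heu => heD u (by have := heu.ne; grind) heu)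
    obtain ⟨a, ha, hda, hTa⟩ := hR.2.2 h
    have hY : y ∈ insert p D := by grind
    have hYR : y ∉ R := fun hh => hdis y hh hY
    have hdR : d ∉ R := fun hh => hdis d hh (by grind)
    refine ((Tiles.path hda.symm hdy (by grind)).of_eq_union (U := insert d (insert y R)) hTa
      (by grind) (by grind)).of_eq_union hT ?_ ?_
    · intro x hx
      have := hdis x
      grind
    · intro x
      have := hdis x
      grind
  · have hcd' : c ∈ D.erase d := by grind
    have c3 := Finset.card_erase_of_mem hd
    have c4 : (insert p (D.erase d)).card = D.card := by
      have := (D.card_pos).2 hD.1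
      rw [Finset.card_insert_of_notMem (by grind), c3]
      omega
    have hD' := hD.erase hd hcl ⟨c, hcd'⟩
    have := (D.card_pos).2 hD.1
    -- The second end `t` is arbitrary. It exists because in this case the order of `D` is a
    -- positive multiple of three.
    obtain ⟨t, ht, htc⟩ := Finset.exists_mem_ne (s := D.erase d) (by omega) c
    have hend2 := (hD'.ended hcd' ht htc.symm).insert_vertex hcd' ⟨t, by simp, ht⟩
      (p := p) (by grind) hpc
    refine (hR.2.1 h).of_eq_union
      (ih _ (by omega) (hend2.good Clique.singleton Clique.singleton) (by omega)) ?_ ?_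
    · intro x hx
      have := hdis x
      grind
    · intro x
      have := hdis x
      grind

/-- A part `D` without cut vertices, with a pendant vertex `p` at `c` and two arms. -/
lemma Arm.tiles_union_union {n : ℕ} {L R : Finset V} {d₁ d₂ e₁ e₂ : V} (hL : Arm G L d₁)
    (hR : Arm G R d₂) (hD : NoCut G D) (hc : c ∈ D) (hd₁ : d₁ ∈ D) (hd₂ : d₂ ∈ D)
    (hcd₁ : c ≠ d₁) (hcd₂ : c ≠ d₂) (hdd : d₁ ≠ d₂)
    (hcl₁ : ∀ a ∈ D, ∀ b ∈ D, G.Adj d₁ a → G.Adj d₁ b → a ≠ b → G.Adj a b)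
    (hcl₂ : ∀ a ∈ D, ∀ b ∈ D, G.Adj d₂ a → G.Adj d₂ b → a ≠ b → G.Adj a b)
    (hp : p ∉ D) (hpc : G.Adj p c)
    (he₁ : e₁ ∉ insert p D) (hed₁ : G.Adj e₁ d₁) (heD₁ : ∀ u ∈ insert p D, G.Adj e₁ u → u = d₁)
    (he₂ : e₂ ∉ insert p D) (hed₂ : G.Adj e₂ d₂) (heD₂ : ∀ u ∈ insert p D, G.Adj e₂ u → u = d₂)
    (hdL : ∀ x ∈ L, x ∉ insert p D) (hdR : ∀ x ∈ R, x ∉ insert p D) (hLR : ∀ x ∈ L, x ∉ R)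
    (h3 : 3 ∣ L.card + R.card + D.card + 1) (hn : D.card + 2 < n)
    (hne : L.card % 3 = 1 → R.card % 3 ≠ 1)
    (ih : ∀ W : Finset V, W.card < n → Good G W → 3 ∣ W.card → Tiles G W) :
    Tiles G (L ∪ R ∪ insert p D) := by
  -- Some arm has residue zero or two. It is tiled alone or together with its vertex of attachment,
  -- whose removal creates no cut vertex in `D`. This reduces to one arm.
  wlog hl : L.card % 3 ≠ 1 generalizing L R d₁ d₂ e₁ e₂
  · rw [Finset.union_comm L R]
    exact this hR hL hd₂ hd₁ hcd₂ hcd₁ hdd.symm hcl₂ hcl₁ he₂ hed₂ heD₂ he₁ hed₁ heD₁ hdR hdL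
      (fun x hx hx' => hLR x hx' hx) (by rwa [add_comm R.card L.card]) (fun h => by omega) (hne (by omega))
  have : L.card % 3 = 0 ∨ L.card % 3 = 2 := by omega
  rcases this with h | h
  · refine (hL.1 h).of_eq_union (hR.tiles_union hD hc hd₂ hcd₂ hcl₂ hp hpc he₂ hed₂ heD₂ hdR
      (by omega) hn ih) ?_ (by grind)
    intro x hx
    have := hdL x hx
    have := hLR x hx
    grind
  · have hD' := hD.erase hd₁ hcl₁ ⟨c, by grind⟩
    have c3 := Finset.card_erase_of_mem hd₁
    have := (D.card_pos).2 hD.1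
    refine (hL.2.1 h).of_eq_union (hR.tiles_union hD' (c := c) (p := p) (e := e₂) (by grind)
      (by grind) hcd₂ (by grind) (by grind) hpc (by grind) hed₂ (by grind) ?_
      (by omega) (by omega) ih) ?_ ?_
    · intro x hx
      have := hdR x hx
      grind
    · intro x hx
      have := hdL x
      have := hLR x
      have := hdR d₁
      grind
    · intro x
      have := hdL x
      have := hLR x
      have := hdR d₁
      grind

/-! ### Two arms in a block minus a vertex -/

/-- Two disjoint parts of `W - z`, each attached to the rest at a single vertex, and both
avoiding `q`. -/
structure Arms (G : SimpleGraph V) (W : Finset V) (z q : V) (A B : Finset V) (a b : V) : Prop where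
  subset_left : A ⊆ W.erase z
  subset_right : B ⊆ W.erase z
  left : A.Nonempty
  right : B.Nonempty
  notMem_left : q ∉ A
  notMem_right : q ∉ B
  apart : Apart G A B
  bdry_left : Bdry G (W.erase z) A a
  bdry_right : Bdry G (W.erase z) B b

namespace Arms
variable {q : V}

lemma symm (h : Arms G W z q A B a b) : Arms G W z q B A b a :=
  ⟨h.2, h.1, h.4, h.3, h.6, h.5, h.7.symm, h.9, h.8⟩

lemma mem (h : Arms G W z q A B a b) (hW : NoCut G W) (hq : q ∈ W.erase z) :
    a ∈ W.erase z ∧ a ∉ A ∧ a ∉ B ∧ ∃ e ∈ A, G.Adj a e := by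
  obtain ⟨e, he, u, hu, huA, heu⟩ := (hW.conn_erase ⟨q, hq⟩).exists_adj h.subset_left h.left hq
    h.notMem_left
  obtain rfl := h.bdry_left e he u hu huA heu
  refine ⟨hu, huA, fun huB => (h.apart e he u huB).2 heu, e, he, heu.symm⟩

/-- Without a neighbour of `z`, the set `E` would be an end-piece of `W` avoiding both `z` and `q`,
although `W` has no cut vertex. -/
lemma exists_adj (h : Arms G W z q A B a b) (hW : NoCut G W) (hz : z ∈ W) (hq : q ∈ W.erase z)
    (hE : E ⊆ A) (hne : E.Nonempty) (hv : Bdry G (insert a A) E v) : ∃ e ∈ E, G.Adj z e := by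
  by_contra! hcon
  have hAW := h.subset_left
  have hqA := h.notMem_left
  have := hW.2 E (by grind) hne v (fun e he u hu huE heu => by
    have huz : u ≠ z := fun hh => hcon e he (hh ▸ heu.symm)
    refine hv e he u ?_ huE heu
    have := h.bdry_left e (hE he) u
    grind)
  have h1 := @this z hz
  have h2 := @this q (by grind)
  grind

lemma exists_adj' (h : Arms G W z q A B a b) (hW : NoCut G W) (hz : z ∈ W) (hq : q ∈ W.erase z) :
    ∃ e ∈ A, G.Adj z e :=
  h.exists_adj hW hz hq (v := a) subset_rfl h.left (fun e he u hu huA heu => by grind)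

lemma clique_z (h : Arms G W z q A B a b) (hG : NoClaw G) (hW : NoCut G W) (hz : z ∈ W)
    (hq : q ∈ W.erase z) :
    ∀ x ∈ A, ∀ y ∈ A, G.Adj z x → G.Adj z y → x ≠ y → G.Adj x y := by
  intro x hx y hy hzx hzy hxy
  obtain ⟨e, he, hze⟩ := h.symm.exists_adj' hW hz hq
  have h1 := h.apart x hx e he
  have h2 := h.apart y hy e he
  have := hG z x y e hzx hzy hze hxy h1.1 h2.1
  tauto

/-- Each of two separated parts of `A` would contain a neighbour of `z`, and these are adjacent by
`clique_z`. -/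
lemma conn (h : Arms G W z q A B a b) (hG : NoClaw G) (hW : NoCut G W) (hz : z ∈ W)
    (hq : q ∈ W.erase z) : Conn G A := by
  refine ⟨h.left, fun E hE hne hc => ?_⟩
  by_contra hAE
  obtain ⟨x, hx, hxE⟩ := Finset.not_subset.1 hAE
  obtain ⟨e, he, hze⟩ := h.exists_adj hW hz hq (v := a) hE hne (fun e he u hu huE heu => by
    have := hc e he u
    grind)
  obtain ⟨f, hf, hzf⟩ := h.exists_adj hW hz hq (v := a) (E := A \ E) (by grind) ⟨x, by grind⟩
    (fun f hf u hu huE heu => by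
      have := hc u
      have := heu.symm
      grind)
  have := hc e he f (by grind)
    (h.clique_z hG hW hz hq e (hE he) f (by grind) hze hzf (by grind))
  grind

/-- If `A` were attached at `q`, the other neighbours of `q` in `W - z` would be adjacent to one in
`A` and hence lie in `A`. Then `A` and `q` would exhaust `W - z`, leaving no room for `B`. -/
lemma ne (h : Arms G W z q A B a b) (hW : NoCut G W) (hq : q ∈ W.erase z)
    (hcl : ∀ x ∈ W, ∀ y ∈ W, G.Adj q x → G.Adj q y → x ≠ y → G.Adj x y) : a ≠ q := by
  rintro rfl
  have hAW := h.subset_left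
  obtain ⟨-, -, -, e, he, hae⟩ := h.mem hW hq
  have := (hW.conn_erase ⟨a, hq⟩).2 (insert a A) (by grind) ⟨a, by simp⟩ (fun f hf u hu hfu => by
    by_contra huA
    have h1 := hcl e (by grind) u (by grind)
    have h2 := h.bdry_left e he u
    have h3 := h.bdry_left f
    grind)
  obtain ⟨b, hb⟩ := h.right
  have h1 := h.apart b
  have h2 := @this b (h.subset_right hb)
  have h3 := h.notMem_right
  grind

/-- A common vertex of attachment would be the centre of a claw with leaves in `A`, in `B` and
outside both. -/
lemma ne' (h : Arms G W z q A B a b) (hG : NoClaw G) (hW : NoCut G W) (hq : q ∈ W.erase z)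
    (haq : a ≠ q) : a ≠ b := by
  rintro rfl
  obtain ⟨haW, haA, haB, e, he, hae⟩ := h.mem hW hq
  obtain ⟨-, -, -, f, hf, haf⟩ := h.symm.mem hW hq
  have hqA := h.notMem_left
  have hqB := h.notMem_right
  obtain ⟨x, hx, u, hu, hux, hxu⟩ := (hW.conn_erase ⟨q, hq⟩).exists_adj
    (E := ((W.erase z) \ (A ∪ B)).erase a) (x := a) (by grind) ⟨q, by grind⟩ haW (by grind)
  have hxa := hxu.symm
  have hua : u = a := by
    by_contra hua
    have h1 := h.bdry_left u
    have h2 := h.bdry_right u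
    grind
  subst hua
  have h1 := h.apart e he f hf
  have h2 := h.bdry_left e he x
  have h3 := h.bdry_right f hf x
  have := ne_of_mem_of_not_mem he (show x ∉ A by grind)
  have := ne_of_mem_of_not_mem hf (show x ∉ B by grind)
  have := hG u e f x hae haf hxa
  grind

/-- A vertex of attachment has a neighbour outside the two arms. -/
lemma exists_adj_center (h : Arms G W z q A B a b) (hG : NoClaw G) (hW : NoCut G W)
    (hq : q ∈ W.erase z) (haq : a ≠ q) : ∃ x ∈ W.erase z, x ∉ A ∧ x ∉ B ∧ G.Adj a x := by
  obtain ⟨haW, haA, haB, -⟩ := h.mem hW hq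
  have hab := h.ne' hG hW hq haq
  have hqA := h.notMem_left
  have hqB := h.notMem_right
  obtain ⟨x, hx, u, hu, hux, hxu⟩ := (hW.conn_erase ⟨q, hq⟩).exists_adj
    (E := ((W.erase z) \ A).erase a) (x := a) (by grind) ⟨q, by grind⟩ haW (by grind)
  have hxa := hxu.symm
  have hua : u = a := by
    by_contra hua
    have h1 := h.bdry_left u
    grind
  subst hua
  refine ⟨x, by grind, by grind, fun hxB => ?_, hxa⟩
  have := h.bdry_right x hxB u
  grind

lemma clique_left (h : Arms G W z q A B a b) (hG : NoClaw G) (hW : NoCut G W)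
    (hq : q ∈ W.erase z) (haq : a ≠ q) :
    ∀ x ∈ A, ∀ y ∈ A, G.Adj a x → G.Adj a y → x ≠ y → G.Adj x y := by
  intro x hx y hy hax hay hxy
  obtain ⟨w, hw, hwA, hwB, haw⟩ := h.exists_adj_center hG hW hq haq
  have h1 := h.bdry_left x hx w hw hwA
  have h2 := h.bdry_left y hy w hw hwA
  have := haw.ne
  have := ne_of_mem_of_not_mem hx hwA
  have := ne_of_mem_of_not_mem hy hwA
  have := hG a x y w hax hay haw
  grind

lemma clique_center (h : Arms G W z q A B a b) (hG : NoClaw G) (hW : NoCut G W)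
    (hq : q ∈ W.erase z) : ∀ x ∈ W.erase z, x ∉ A → ∀ y ∈ W.erase z, y ∉ A →
      G.Adj a x → G.Adj a y → x ≠ y → G.Adj x y := by
  intro x hx hxA y hy hyA hax hay hxy
  obtain ⟨haW, haA, haB, e, he, hae⟩ := h.mem hW hq
  have h1 := h.bdry_left e he x hx hxA
  have h2 := h.bdry_left e he y hy hyA
  have := hax.ne
  have := hay.ne
  have := ne_of_mem_of_not_mem he hxA
  have := ne_of_mem_of_not_mem he hyA
  have := hG a e x y hae hax hay
  grind

/-- Each side of a cut vertex `v` of the centre must contain `a` or `b`, since otherwise `z` is the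
centre of a claw. So `v` separates `a` from `b`, and an arm can be enlarged by a side of `v`
avoiding `q`, against maximality. -/
lemma noCut_center (h : Arms G W z q A B a b) (hG : NoClaw G) (hW : NoCut G W) (hz : z ∈ W)
    (hq : q ∈ W.erase z) (hcl : ∀ x ∈ W, ∀ y ∈ W, G.Adj q x → G.Adj q y → x ≠ y → G.Adj x y)
    (hmax : ∀ A' B' a' b', Arms G W z q A' B' a' b' → A'.card + B'.card ≤ A.card + B.card) :
    NoCut G (W.erase z \ (A ∪ B)) := by
  have hqA := h.notMem_left
  have hqB := h.notMem_right
  have hAW := h.subset_left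
  have hBW := h.subset_right
  have hC := hW.conn_erase ⟨q, hq⟩
  -- An end-piece `Q` containing neither `a` nor `b` is not joined to the arms, so it contains a
  -- neighbour of `z`. This gives a claw at `z` with leaves in `A`, `B` and `Q`.
  have key1 : ∀ Q ⊆ W.erase z \ (A ∪ B), ∀ v, Q.Nonempty → Bdry G (W.erase z \ (A ∪ B)) Q v →
      a ∉ Q → b ∉ Q → False := by
    intro Q hQ v hne hv haQ hbQ
    have hQA : Apart G A Q := fun e he f hf => ⟨by grind, fun hef => by
      have := h.bdry_left e he f
      grind⟩
    have hQB : Apart G B Q := fun e he f hf => ⟨by grind, fun hef => by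
      have := h.bdry_right e he f
      grind⟩
    have : ∃ x ∈ Q, G.Adj z x := by
      by_contra! hcon
      have := hW.2 Q (by grind) hne v (fun e he u hu huQ heu => by
        have huz : u ≠ z := fun hh => hcon e he (hh ▸ heu.symm)
        have h1 := hQA u
        have h2 := hQB u
        have := heu.symm
        have := hv e he u
        grind)
      obtain ⟨x, hx⟩ := h.left
      obtain ⟨y, hy⟩ := h.right
      have hxy := h.apart x hx y hy
      have h1 := @this x (by grind)
      have h2 := @this y (by grind)
      grind
    obtain ⟨x, hx, hzx⟩ := this
    obtain ⟨e, he, hze⟩ := h.exists_adj' hW hz hq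
    obtain ⟨f, hf, hzf⟩ := h.symm.exists_adj' hW hz hq
    have h1 := h.apart e he f hf
    have h2 := hQA e he x hx
    have h3 := hQB f hf x hx
    have := hG z e f x hze hzf hzx h1.1 h2.1 h3.1
    tauto
  -- If `q` lies in `P` or `Q`, the other set enlarges its arm. If `q = v`, then `q` has neighbours
  -- in both `A ∪ P` and `B ∪ Q`, which would have to be adjacent.
  have key2 : ∀ P Q : Finset V, ∀ v, P ⊆ W.erase z \ (A ∪ B) → Q ⊆ W.erase z \ (A ∪ B) →
      v ∉ P → v ∉ Q → (∀ x ∈ W.erase z \ (A ∪ B), x = v ∨ x ∈ P ∨ x ∈ Q) → Apart G P Q →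
      a ∈ P → b ∈ Q → False := by
    intro P Q v hP hQ hvP hvQ hPQ hap haP hbQ
    have hap' := hap.symm
    have hAQ : Apart G A Q := fun e he f hf => ⟨by grind, fun hef => by
      have := h.bdry_left e he f
      have := (hap a haP f hf).1
      grind⟩
    have hBP : Apart G B P := fun e he f hf => ⟨by grind, fun hef => by
      have := h.bdry_right e he f
      have := (hap f hf b hbQ).1
      grind⟩
    have hAB := h.apart
    have hBA := h.apart.symm
    have b1 : Bdry G (W.erase z) (A ∪ P) v := by
      intro e he u hu huE heu
      have h1 := h.bdry_left e
      have h2 := hBP u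
      have h3 := hap e
      have h4 := hPQ u
      have h5 := heu.symm
      have h6 := hAB e
      have h7 := hAQ e
      grind
    have b2 : Bdry G (W.erase z) (B ∪ Q) v := by
      intro e he u hu huE heu
      have h1 := h.bdry_right e
      have h2 := hAQ u
      have h3 := hap' e
      have h4 := hPQ u
      have h5 := heu.symm
      have h6 := hBA e
      have h7 := hBP e
      grind
    have apAP : Apart G (A ∪ P) B := by
      intro e he f hf
      have := hBP f hf e
      have := hAB e
      have := G.adj_comm e f
      grind
    have apBQ : Apart G A (B ∪ Q) := by
      intro e he f hf
      have := hAQ e he f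
      have := hAB e
      grind
    have hPA : Disjoint A P := Finset.disjoint_left.2 (by grind)
    have hQB : Disjoint B Q := Finset.disjoint_left.2 (by grind)
    have cP := Finset.card_pos.2 ⟨a, haP⟩
    have cQ := Finset.card_pos.2 ⟨b, hbQ⟩
    rcases hPQ q (by grind) with hqv | hqP | hqQ
    · subst hqv
      obtain ⟨e, he, u, hu, huE, heu⟩ := hC.exists_adj (E := A ∪ P) (by grind) (h.left.mono (by grind)) hq
        (by grind)
      obtain ⟨f, hf, w, hw, hwE, hfw⟩ := hC.exists_adj (E := B ∪ Q) (by grind) (h.right.mono (by grind)) hq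
        (by grind)
      obtain rfl := b1 e he u hu huE heu
      obtain rfl := b2 f hf w hw hwE hfw
      have hdis : e ≠ f ∧ ¬ G.Adj e f := by
        have := hAB e
        have := hAQ e
        have := hBP f
        have := hap e
        have := G.adj_comm e f
        grind
      exact hdis.2 (hcl e (by grind) f (by grind) heu.symm hfw.symm hdis.1)
    · have := hmax A (B ∪ Q) a v ⟨hAW, by grind, h.left, h.right.mono (by grind), hqA,
        by have := hap q hqP q; grind, apBQ, h.bdry_left, b2⟩
      rw [Finset.card_union_of_disjoint hQB] at this
      omega
    · have := hmax (A ∪ P) B v b ⟨by grind, hBW, h.left.mono (by grind), h.right,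
        by have := hap' q hqQ q; grind, hqB, apAP, b1, h.bdry_right⟩
      rw [Finset.card_union_of_disjoint hPA] at this
      omega
  refine ⟨⟨q, by grind⟩, fun E hE hne v₀ hv₀ => ?_⟩
  by_contra hsub
  obtain ⟨w, hw, hwE⟩ := Finset.not_subset.1 hsub
  -- If `v₀` lies in `E`, then `E` has no boundary vertex in the centre and any vertex outside the
  -- centre may replace `v₀`; here it is `z`.
  obtain ⟨v, hvE, hv, hwv⟩ : ∃ v, v ∉ E ∧ Bdry G (W.erase z \ (A ∪ B)) E v ∧ w ≠ v := by
    by_cases hvE : v₀ ∈ E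
    · refine ⟨z, by grind, fun e he u hu huE heu => ?_, by grind⟩
      have := hv₀ e he u hu huE heu
      grind
    · exact ⟨v₀, hvE, hv₀, by grind⟩
  set F := ((W.erase z \ (A ∪ B)) \ E).erase v with hF
  have hap : Apart G E F := fun e he f hf => ⟨by grind, fun hef => by
    have := hv e he f
    grind⟩
  have hbF : Bdry G (W.erase z \ (A ∪ B)) F v := by
    intro f hf u hu huF hfu
    have := (hap u · f hf)
    have := hfu.symm
    grind
  have k1 := key1 E hE v hne hv
  have k2 := key1 F (by grind) v ⟨w, by grind⟩ hbF
  have k3 := key2 E F v hE (by grind) hvE (by grind) (by grind) hap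
  have k4 := key2 F E v (by grind) hE (by grind) hvE (by grind) hap.symm
  have hdisj : ∀ x ∈ E, x ∉ F := by grind
  have := hdisj a
  have := hdisj b
  clear_value F
  tauto

end Arms

/-! ### The ends of an arm -/

/-- `L` is attached to the rest of the graph at `a`; besides, every end-piece of `L` meets `S` or
the set `T` of neighbours of `a`. -/
structure Legs (G : SimpleGraph V) (L S T : Finset V) (a : V) : Prop where
  ended : Ended G L S T
  ended_insert : Ended G (insert a L) S {a}
  clique : Clique G T
  exists_mem : ∃ t ∈ T, t ∈ L

lemma Legs.insert_vertex {L : Finset V} (h : Legs G L {b} T a) (hb : b ∈ L) (hp : p ∉ L)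
    (hpa : p ≠ a) (hpb : G.Adj p b) : Legs G (insert p L) {p} T a := by
  refine ⟨h.ended.insert_vertex hb h.exists_mem hp hpb, ?_, h.clique, ?_⟩
  · rw [Finset.insert_comm]
    exact h.ended_insert.insert_vertex (by simp [hb]) ⟨a, by simp, by simp⟩ (by simp [hp, hpa]) hpb
  · obtain ⟨t, ht, htL⟩ := h.exists_mem
    exact ⟨t, ht, by simp [htL]⟩

/-- One end is always `S`. The other is `T`, then `a`, then `y`, for the three sets required by
`Arm.of_good`. -/
lemma Legs.arm {n : ℕ} {L : Finset V} (h : Legs G L S T a) (hS : Clique G S) (hne : ∃ s ∈ S, s ∈ L)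
    (ha : a ∉ L) (hy : y ∉ L) (hya : G.Adj y a) (hyL : ∀ u ∈ L, ¬ G.Adj y u) (hn : L.card + 2 < n)
    (ih : ∀ W : Finset V, W.card < n → Good G W → 3 ∣ W.card → Tiles G W) : Arm G L a := by
  obtain ⟨s, hs, hsL⟩ := hne
  have hya' := hya.ne
  have hE := h.ended_insert.symm.insert_vertex (p := y) (by simp) ⟨s, hs, by simp [hsL]⟩
    (by simp [hy, hya']) hya
  refine Arm.of_good (y := y) (h.ended.good hS h.clique) (h.ended_insert.good hS Clique.singleton)
    (hE.good Clique.singleton hS) ha (by simp [hy, hya']) (fun u hu hyu => ?_) hn ih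
  rcases Finset.mem_insert.1 hu with rfl | hu
  · rfl
  · exact (hyL u hu hyu).elim

/-- For `T` take the neighbours of `a` in `A`. An end-piece of `L` avoiding `S` and `T` is not
joined to `a`, so it stays an end-piece after `a` is added and `hb` excludes it. -/
lemma Arms.exists_legs {q : V} {L : Finset V} (h : Arms G W z q A B a b) (hG : NoClaw G)
    (hW : NoCut G W) (hq : q ∈ W.erase z) (haq : a ≠ q) (hL : Conn G L) (hAL : A ⊆ L)
    (hLS : ∀ x ∈ L, x ∈ A ∨ x ∈ S)
    (hb : ∀ E ⊆ A, E.Nonempty → (∀ s ∈ S, s ∉ E) → ∀ v, ¬ Bdry G (insert a L) E v) :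
    ∃ T, Legs G L S T a := by
  classical
  obtain ⟨haW, haA, haB, e, he, hae⟩ := h.mem hW hq
  have hcl := h.clique_left hG hW hq haq
  refine ⟨A.filter (G.Adj a), ⟨hL, fun E hE hne hS hT v hv => ?_⟩,
    ⟨hL.insert_vertex (hAL he) hae, fun E hE hne hS hT v hv => ?_⟩, ?_, ⟨e, by simp [he, hae], hAL he⟩⟩
  · refine hb E (fun x hx => ?_) hne hS v (fun e he u hu huE heu => ?_)
    · have := hLS x (hE hx)
      have := hS x
      tauto
    · rcases Finset.mem_insert.1 hu with rfl | hu
      · have h1 := hS e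
        have h2 := hLS e (hE he)
        have := hT e
        simp only [Finset.mem_filter] at this
        exact (this ⟨by tauto, heu.symm⟩ he).elim
      · exact hv e he u hu huE heu
  · refine hb E (fun x hx => ?_) hne hS v hv
    have := hS x
    rcases Finset.mem_insert.1 (hE hx) with rfl | hx'
    · exact (hT x (by simp) hx).elim
    · have := hLS x hx'
      tauto
  · intro x hx y hy hxy
    simp only [Finset.mem_filter] at hx hy
    exact hcl x hx.1 y hy.1 hx.2 hy.2 hxy

/-- Here `S` is the clique of neighbours of `z` in `A`, which `Arms.exists_adj` shows to meet every
relevant end-piece. -/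
lemma Arms.exists_legs_self {q : V} (h : Arms G W z q A B a b) (hG : NoClaw G)
    (hW : NoCut G W) (hz : z ∈ W) (hq : q ∈ W.erase z) (haq : a ≠ q) :
    ∃ S T, Legs G A S T a ∧ Clique G S ∧ ∃ s ∈ S, s ∈ A := by
  classical
  obtain ⟨u, hu, hzu⟩ := h.exists_adj' hW hz hq
  have hcl := h.clique_z hG hW hz hq
  obtain ⟨T, hT⟩ := h.exists_legs (S := A.filter (G.Adj z)) hG hW hq haq (h.conn hG hW hz hq)
    subset_rfl (fun x hx => Or.inl hx) (fun E hE hne hS v hv => by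
      obtain ⟨e, he, hze⟩ := h.exists_adj hW hz hq hE hne hv
      exact hS e (by simp [hE he, hze]) he)
  refine ⟨_, T, hT, ?_, u, by simp [hu, hzu], hu⟩
  intro x hx y hy hxy
  simp only [Finset.mem_filter] at hx hy
  exact hcl x hx.1 y hy.1 hx.2 hy.2 hxy

/-- An end-piece inside `A` contains a neighbour of `z`, hence of `c`, so its boundary vertex is
`c`. By connectivity it is all of `A`, but then `a` is a second boundary vertex. -/
lemma Arms.exists_legs_insert {q : V} (h : Arms G W z q A B a b) (hG : NoClaw G)
    (hW : NoCut G W) (hz : z ∈ W) (hq : q ∈ W.erase z) (haq : a ≠ q) (hca : c ≠ a) (hcA : c ∉ A)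
    (hcz : ∀ u ∈ A, G.Adj z u → G.Adj c u) : ∃ T, Legs G (insert c A) {c} T a := by
  obtain ⟨haW, haA, haB, e₁, he₁, hae₁⟩ := h.mem hW hq
  obtain ⟨u, hu, hzu⟩ := h.exists_adj' hW hz hq
  have hconn := h.conn hG hW hz hq
  refine h.exists_legs hG hW hq haq (hconn.insert_vertex hu (hcz u hu hzu))
    (Finset.subset_insert _ _) (by simp; tauto) (fun E hE hne hS v hv => ?_)
  have hcE : c ∉ E := fun hh => hcA (hE hh)
  obtain ⟨e, he, hze⟩ := h.exists_adj hW hz hq hE hne (v := v)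
    (fun e he u hu huE heu => hv e he u (by grind) huE heu)
  have hvc := hv e he c (by simp) hcE (hcz e (hE he) hze).symm
  have hAE := hconn.2 E hE hne (fun e he u hu heu => by
    have := hv e he u
    grind)
  have := hv e₁ (hAE he₁) a (by simp) (fun hh => haA (hE hh)) hae₁.symm
  exact hca (by rw [this, hvc])

/-- All neighbours in `W` of a subset of `A` lie in `A` or are `a` or `z`. An end-piece inside `A`
would thus be one of `W` missing both `a` and `q`. -/
lemma Arms.exists_legs_insert_z {q : V} (h : Arms G W z q A B a b) (hG : NoClaw G)
    (hW : NoCut G W) (hz : z ∈ W) (hq : q ∈ W.erase z) (haq : a ≠ q) :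
    ∃ T, Legs G (insert z A) {z} T a := by
  obtain ⟨haW, haA, haB, e₁, he₁, hae₁⟩ := h.mem hW hq
  obtain ⟨u, hu, hzu⟩ := h.exists_adj' hW hz hq
  have hconn := h.conn hG hW hz hq
  refine h.exists_legs hG hW hq haq (hconn.insert_vertex hu hzu)
    (Finset.subset_insert _ _) (by simp; tauto) (fun E hE hne hS v hv => ?_)
  have hAW := h.subset_left
  have := hW.2 E (by grind) hne v (fun e he u hu huE heu => by
    have h1 := h.bdry_left e (hE he) u
    have := hv e he u
    grind)
  have hqA := h.notMem_left
  have h1 := @this a (by grind)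
  have h2 := @this q (by grind)
  grind

/-- A part `D` without cut vertices, with two pendant vertices `p` at `c` and `r` at `q`, where the
removal of `p`, `c` and a neighbour `z` of `c` leaves two arms besides `r`. -/
lemma Arms.tiles {n : ℕ} {q r : V} (h : Arms G W z q A B a b) (hG : NoClaw G) (hW : NoCut G W)
    (hz : z ∈ W) (hq : q ∈ W.erase z)
    (hclq : ∀ x ∈ W, ∀ y ∈ W, G.Adj q x → G.Adj q y → x ≠ y → G.Adj x y)
    (hmax : ∀ A' B' a' b', Arms G W z q A' B' a' b' → A'.card + B'.card ≤ A.card + B.card)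
    (hc : c ∉ W) (hcz : G.Adj c z)
    (hclc : ∀ x ∈ W, ∀ y ∈ W, G.Adj c x → G.Adj c y → x ≠ y → G.Adj x y)
    (hp : p ∉ insert c W) (hpc : G.Adj p c) (hpn : ∀ u ∈ W, ¬ G.Adj p u)
    (hr : r ∉ insert c W) (hrq : G.Adj r q) (hrn : ∀ u ∈ W, G.Adj r u → u = q)
    (hpr : p ≠ r) (hcA : ∃ u ∈ A, G.Adj z u ∧ G.Adj c u) (hn : n = W.card + 3) (h3 : 3 ∣ n)
    (ih : ∀ W : Finset V, W.card < n → Good G W → 3 ∣ W.card → Tiles G W) :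
    Tiles G (insert p (insert r (insert c W))) := by
  classical
  have hAW := h.subset_left
  have hBW := h.subset_right
  have hqA := h.notMem_left
  have hqB := h.notMem_right
  have hap := h.apart
  have hac := G.adj_comm
  obtain ⟨haW, haA, haB, e₁, he₁, hae₁⟩ := h.mem hW hq
  obtain ⟨hbW, hbB, hbA, e₂, he₂, hbe₂⟩ := h.symm.mem hW hq
  have haq := h.ne hW hq hclq
  have hbq := h.symm.ne hW hq hclq
  have hab := h.ne' hG hW hq haq
  obtain ⟨uA, huA, hzA⟩ := h.exists_adj' hW hz hq
  obtain ⟨uB, huB, hzB⟩ := h.symm.exists_adj' hW hz hq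
  have hdAB : ∀ x ∈ A, x ∉ B := fun x hx hx' => (hap x hx x hx').1 rfl
  obtain ⟨u₀, hu₀, hzu₀, hcu₀⟩ := hcA
  -- The neighbours of `c` in `W` form a clique containing `u₀ ∈ A`, so they cannot leave `A` except
  -- at `z` or `a`.
  have hcn : ∀ u ∈ W, G.Adj c u → u ∈ A ∨ u = z ∨ u = a := by
    intro u hu hcu
    by_contra! hcon
    have h1 := hclc u hu u₀ (by grind) hcu hcu₀ (by grind)
    have := h.bdry_left u₀ hu₀ u (by grind) hcon.1 h1.symm
    grind
  -- Otherwise `z` is the centre of a claw with leaves `c`, `u` and `uB`.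
  have hcA : ∀ u ∈ A, G.Adj z u → G.Adj c u := by
    intro u hu hzu
    have h1 := hap u hu uB huB
    have h2 := hcn uB (by grind)
    have := hG z c u uB hcz.symm hzu hzB (by grind) (by grind) h1.1
    grind
  -- Any other such neighbour would give a claw at `z` with leaves `uA`, `uB` and `x`.
  have hzD : ∀ x ∈ W.erase z \ (A ∪ B), G.Adj z x → x = a ∨ x = b := by
    intro x hx hzx
    have h1 := hap uA huA uB huB
    have h2 := h.bdry_left uA huA x
    have h3 := h.bdry_right uB huB x
    have := hG z uA uB x hzA hzB hzx h1.1 (by grind) (by grind)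
    grind
  have hD := h.noCut_center hG hW hz hq hclq hmax
  have hconnA := h.conn hG hW hz hq
  have hconnB := h.symm.conn hG hW hz hq
  have hclzA := h.clique_z hG hW hz hq
  have hclaA := h.clique_left hG hW hq haq
  have hclbB := h.symm.clique_left hG hW hq hbq
  have hcla := h.clique_center hG hW hq
  have hclb := h.symm.clique_center hG hW hq
  obtain ⟨y₁, hy₁W, hy₁A, hy₁B, hay₁⟩ := h.exists_adj_center hG hW hq haq
  clear hclq hmax
  obtain ⟨D, hDdef⟩ : ∃ D, D = W.erase z \ (A ∪ B) := ⟨_, rfl⟩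
  rw [← hDdef] at hD hzD
  have mD : ∀ x, x ∈ D ↔ x ∈ W ∧ x ≠ z ∧ x ∉ A ∧ x ∉ B := by
    intro x
    simp only [hDdef, Finset.mem_sdiff, Finset.mem_erase, Finset.mem_union]
    tauto
  have haD : a ∈ D := (mD a).2 ⟨Finset.mem_of_mem_erase haW, Finset.ne_of_mem_erase haW, haA, haB⟩
  have hbD : b ∈ D := (mD b).2 ⟨Finset.mem_of_mem_erase hbW, Finset.ne_of_mem_erase hbW, hbA, hbB⟩
  have hqD : q ∈ D := (mD q).2 ⟨Finset.mem_of_mem_erase hq, Finset.ne_of_mem_erase hq, hqA, hqB⟩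
  have hD3 : 3 ≤ D.card := by
    have : ({a, b, q} : Finset V) ⊆ D := by
      simp [Finset.insert_subset_iff, haD, hbD, hqD]
    have h1 := Finset.card_le_card this
    rwa [Finset.card_eq_three.2 ⟨a, b, q, hab, haq, hbq, rfl⟩] at h1
  obtain ⟨y₂, hy₂D, hy₂a, hby₂⟩ := hD.exists_adj_ne hD3 hbD a
  have hcard : W.card = A.card + B.card + D.card + 1 := by
    have h0 : A ∪ B ⊆ W.erase z := Finset.union_subset hAW hBW
    have h1 : D.card = (W.erase z).card - (A ∪ B).card := by
      rw [hDdef, Finset.card_sdiff_of_subset h0]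
    have h2 : (A ∪ B).card = A.card + B.card :=
      Finset.card_union_of_disjoint (Finset.disjoint_left.2 hdAB)
    have h3 : (A ∪ B).card ≤ (W.erase z).card := Finset.card_le_card h0
    have h4 := Finset.card_erase_of_mem hz
    have h5 := Finset.card_pos.2 ⟨z, hz⟩
    omega
  have hAp := h.left.card_pos
  have hBp := h.right.card_pos
  have wc : ∀ x ∈ W, x ≠ c ∧ x ≠ p ∧ x ≠ r := by grind
  have pc := hpc.ne
  have rc : r ≠ c := by grind
  have mA : ∀ x ∈ A, x ∈ W ∧ x ≠ z ∧ x ≠ c ∧ x ≠ p ∧ x ≠ r ∧ x ∉ B ∧ x ∉ D := by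
    intro x hx
    have h1 := Finset.mem_erase.1 (hAW hx)
    have h2 := wc x h1.2
    exact ⟨h1.2, h1.1, h2.1, h2.2.1, h2.2.2, hdAB x hx, fun hh => ((mD x).1 hh).2.2.1 hx⟩
  have mB : ∀ x ∈ B, x ∈ W ∧ x ≠ z ∧ x ≠ c ∧ x ≠ p ∧ x ≠ r ∧ x ∉ A ∧ x ∉ D := by
    intro x hx
    have h1 := Finset.mem_erase.1 (hBW hx)
    have h2 := wc x h1.2
    exact ⟨h1.2, h1.1, h2.1, h2.2.1, h2.2.2, fun hh => hdAB x hh hx,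
      fun hh => ((mD x).1 hh).2.2.2 hx⟩
  have ac := wc a (Finset.mem_of_mem_erase haW)
  have bc := wc b (Finset.mem_of_mem_erase hbW)
  have zc := wc z hz
  have az := Finset.ne_of_mem_erase haW
  have bz := Finset.ne_of_mem_erase hbW
  have mDc : ∀ x ∈ D, x ≠ c ∧ x ≠ p ∧ x ≠ r := fun x hx => wc x ((mD x).1 hx).1
  have cA : c ∉ A := fun hh => (mA c hh).2.2.1 rfl
  have pA : p ∉ A := fun hh => (mA p hh).2.2.2.1 rfl
  have zA : z ∉ A := fun hh => (mA z hh).2.1 rfl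
  have zB : z ∉ B := fun hh => (mB z hh).2.1 rfl
  have cB : c ∉ B := fun hh => (mB c hh).2.2.1 rfl
  have pB : p ∉ B := fun hh => (mB p hh).2.2.2.1 rfl
  have rD : r ∉ D := fun hh => (mDc r hh).2.2 rfl
  have hy₁D : y₁ ∈ D := (mD y₁).2
    ⟨Finset.mem_of_mem_erase hy₁W, Finset.ne_of_mem_erase hy₁W, hy₁A, hy₁B⟩
  have hy₂W := (mD y₂).1 hy₂D
  have y₁c := mDc y₁ hy₁D
  have y₂c := mDc y₂ hy₂D
  have ne₁ := hay₁.ne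
  have ne₂ := hby₂.ne
  have n₁A : ∀ u ∈ A, ¬ G.Adj y₁ u := fun u hu hyu =>
    ne₁.symm (h.bdry_left u hu y₁ hy₁W hy₁A hyu.symm)
  have n₂B : ∀ u ∈ B, ¬ G.Adj y₂ u := fun u hu hyu =>
    ne₂.symm (h.bdry_right u hu y₂ (Finset.mem_erase.2 ⟨hy₂W.2.1, hy₂W.1⟩) hy₂W.2.2.2 hyu.symm)
  have n₁c : ¬ G.Adj y₁ c := by
    intro hyc
    rcases hcn y₁ (Finset.mem_of_mem_erase hy₁W) hyc.symm with hh | hh | hh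
    · exact hy₁A hh
    · exact Finset.ne_of_mem_erase hy₁W hh
    · exact ne₁ hh.symm
  have n₂c : ¬ G.Adj y₂ c := by
    intro hyc
    rcases hcn y₂ hy₂W.1 hyc.symm with hh | hh | hh
    · exact hy₂W.2.2.1 hh
    · exact hy₂W.2.1 hh
    · exact hy₂a hh
  have n₁p : ¬ G.Adj y₁ p := fun hyp => hpn y₁ (Finset.mem_of_mem_erase hy₁W) hyp.symm
  have n₂p : ¬ G.Adj y₂ p := fun hyp => hpn y₂ hy₂W.1 hyp.symm
  have n₂z : ¬ G.Adj y₂ z := by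
    intro hyz
    rcases hzD y₂ hy₂D hyz.symm with hh | hh
    · exact hy₂a hh
    · exact ne₂ hh.symm
  have cA2 : (insert p (insert c A)).card = A.card + 2 := by
    rw [Finset.card_insert_of_notMem (by simp [pc, pA]), Finset.card_insert_of_notMem cA]
  have cB1 : (insert z B).card = B.card + 1 := Finset.card_insert_of_notMem zB
  have cB3 : (insert p (insert c (insert z B))).card = B.card + 3 := by
    rw [Finset.card_insert_of_notMem (by simp [pc, pB, zc.2.1.symm]),
      Finset.card_insert_of_notMem (by simp [cB, zc.1.symm]), cB1]
  obtain ⟨S₀, T₀, legs, hS₀, hne₀⟩ := h.exists_legs_self hG hW hz hq haq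
  obtain ⟨T₁, legsc⟩ := h.exists_legs_insert hG hW hz hq haq ac.1.symm cA hcA
  obtain ⟨T₂, legsz⟩ := h.symm.exists_legs_insert_z hG hW hz hq hbq
  have legspc := legsc.insert_vertex (p := p) (by simp) (by simp [pc, pA]) ac.2.1.symm hpc
  have legscz := legsz.insert_vertex (p := c) (by simp) (by simp [cB, zc.1.symm]) bc.1.symm hcz
  have legspcz := legscz.insert_vertex (p := p) (by simp) (by simp [pc, pB, zc.2.1.symm])
    bc.2.1.symm hpc
  clear hclzA hclaA hclbB hconnA hconnB legsc legscz
  have center : ∀ L R : Finset V, Arm G L a → Arm G R b → (∀ x ∈ L, x ∉ insert r D) →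
      (∀ x ∈ R, x ∉ insert r D) → (∀ x ∈ L, x ∉ R) → 3 ∣ L.card + R.card + D.card + 1 →
      (L.card % 3 = 1 → R.card % 3 ≠ 1) → Tiles G (L ∪ R ∪ insert r D) := by
    intro L R hL hR hLD hRD hLR h3 hne
    refine hL.tiles_union_union hR hD hqD haD hbD haq.symm hbq.symm hab ?_ ?_ rD hrq
      (e₁ := e₁) (e₂ := e₂) (by simp [mA e₁ he₁]) hae₁.symm ?_ (by simp [mB e₂ he₂]) hbe₂.symm ?_
      hLD hRD hLR h3 (by omega) hne ih
    · intro x hx y hy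
      have h1 := (mD x).1 hx
      have h2 := (mD y).1 hy
      exact hcla x (Finset.mem_erase.2 ⟨h1.2.1, h1.1⟩) h1.2.2.1 y
        (Finset.mem_erase.2 ⟨h2.2.1, h2.1⟩) h2.2.2.1
    · intro x hx y hy
      have h1 := (mD x).1 hx
      have h2 := (mD y).1 hy
      exact hclb x (Finset.mem_erase.2 ⟨h1.2.1, h1.1⟩) h1.2.2.2 y
        (Finset.mem_erase.2 ⟨h2.2.1, h2.1⟩) h2.2.2.2
    · intro u hu he
      rcases Finset.mem_insert.1 hu with rfl | hu
      · exact (hqA (hrn e₁ (mA e₁ he₁).1 he.symm ▸ he₁)).elim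
      · have h1 := (mD u).1 hu
        exact h.bdry_left e₁ he₁ u (Finset.mem_erase.2 ⟨h1.2.1, h1.1⟩) h1.2.2.1 he
    · intro u hu he
      rcases Finset.mem_insert.1 hu with rfl | hu
      · exact (hqB (hrn e₂ (mB e₂ he₂).1 he.symm ▸ he₂)).elim
      · have h1 := (mD u).1 hu
        exact h.bdry_right e₂ he₂ u (Finset.mem_erase.2 ⟨h1.2.1, h1.1⟩) h1.2.2.2 he
  clear hcla hclb hclc hcn hzD
  -- The centre lemma excludes exactly the case of two arms of residue one. If `A` and `B` both have
  -- it, `c` and `p` extend `A` and `z` extends `B`, giving residues zero and two. Otherwise `z`,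
  -- `c`, `p` all extend `B`, which leaves both residues unchanged.
  by_cases hmod : A.card % 3 = 1 ∧ B.card % 3 = 1
  · have hL : Arm G (insert p (insert c A)) a := legspc.arm (y := y₁) Clique.singleton
      ⟨p, by simp, by simp⟩ (by simp [haA, ac]) (by simp [y₁c, hy₁A]) hay₁.symm
      (by simpa [n₁c, n₁p] using n₁A) (by omega) ih
    have hR : Arm G (insert z B) b := legsz.arm (y := y₂) Clique.singleton
      ⟨z, by simp, by simp⟩ (by simp [hbB, bz]) (by simp [hy₂W]) hby₂.symm
      (by simpa [n₂z] using n₂B) (by omega) ih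
    have := center _ _ hL hR ?_ ?_ ?_ (by omega) (by omega)
    · convert this using 1
      ext x
      have := mA x
      have := mB x
      have := mD x
      simp only [Finset.mem_insert, Finset.mem_union]
      grind
    · intro x
      have := mA x
      have := mDc x
      simp only [Finset.mem_insert]
      grind
    · intro x
      have := mB x
      have := mD x
      simp only [Finset.mem_insert]
      grind
    · intro x
      have := mA x
      have := mB x
      simp only [Finset.mem_insert]
      grind
  · have hL : Arm G A a := legs.arm (y := y₁) hS₀ hne₀ haA hy₁A hay₁.symm n₁A (by omega) ih
    have hR : Arm G (insert p (insert c (insert z B))) b := legspcz.arm (y := y₂) Clique.singleton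
      ⟨p, by simp, by simp⟩ (by simp [hbB, bz, bc]) (by simp [hy₂W, y₂c]) hby₂.symm
      (by simpa [n₂z, n₂c, n₂p] using n₂B) (by omega) ih
    have := center _ _ hL hR ?_ ?_ ?_ (by omega) (by omega)
    · convert this using 1
      ext x
      have := mA x
      have := mB x
      have := mD x
      simp only [Finset.mem_insert, Finset.mem_union]
      grind
    · intro x
      have := mA x
      have := mDc x
      simp only [Finset.mem_insert]
      grind
    · intro x
      have := mB x
      have := mD x
      have := mDc x
      simp only [Finset.mem_insert]
      grind
    · intro x
      have := mA x
      have := mB x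
      simp only [Finset.mem_insert]
      grind

/-! ### The inductive step with pendant vertices -/

/-- A graph without cut vertices with two pendant vertices `p` at `c` and `r` at `q` added. -/
lemma NoCut.tiles_insert_insert {n : ℕ} {q r : V} (hD : NoCut G D) (hG : NoClaw G) (hc : c ∈ D)
    (hq : q ∈ D) (hcq : c ≠ q)
    (hclc : ∀ x ∈ D, ∀ y ∈ D, G.Adj c x → G.Adj c y → x ≠ y → G.Adj x y)
    (hclq : ∀ x ∈ D, ∀ y ∈ D, G.Adj q x → G.Adj q y → x ≠ y → G.Adj x y)
    (hp : p ∉ D) (hpc : G.Adj p c) (hpn : ∀ u ∈ D, G.Adj p u → u = c)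
    (hr : r ∉ D) (hrq : G.Adj r q) (hrn : ∀ u ∈ D, G.Adj r u → u = q)
    (hpr : p ≠ r) (hn : n = D.card + 2) (h3 : 3 ∣ n)
    (ih : ∀ W : Finset V, W.card < n → Good G W → 3 ∣ W.card → Tiles G W) :
    Tiles G (insert p (insert r D)) := by
  classical
  have hD4 : 4 ≤ D.card := by
    have : ({c, q} : Finset V) ⊆ D := by grind
    have h1 := Finset.card_le_card this
    rw [Finset.card_pair hcq] at h1
    omega
  have hDc := Finset.card_erase_of_mem hc
  have hW := hD.erase hc hclc (Finset.card_pos.1 (by omega))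
  -- The path `p`, `c`, `z` is to be removed. The choice `z ≠ q` keeps `r` attached.
  obtain ⟨z, hzD, hzq, hcz⟩ := hD.exists_adj_ne (by omega) hc q
  have hzc := hcz.ne
  have hz : z ∈ D.erase c := by grind
  have hDz := Finset.card_erase_of_mem hz
  have hqW : q ∈ (D.erase c).erase z := by grind
  set W := D.erase c with hWdef
  have hC := hW.conn_erase ⟨q, hqW⟩
  have hX : Conn G (insert r (W.erase z)) := hC.insert_vertex hqW hrq
  by_cases hgood : Good G (insert r (W.erase z))
  · have hcX : (insert r (W.erase z)).card = D.card - 1 := by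
      rw [Finset.card_insert_of_notMem (by grind)]; omega
    exact (ih _ (by omega) hgood (by omega)).of_eq_union (Tiles.path hpc hcz (by grind))
      (by grind) (by grind)
  have hac := G.adj_comm
  -- Take three separated end-pieces. If one contains `r`, the other two avoid `q` and are arms. If
  -- none does, each contains a neighbour of `z`, which is a claw.
  have hex : ∃ A B a b, Arms G W z q A B a b := by
    by_contra hcon
    refine hgood ⟨hX, ?_⟩
    have adjz : ∀ E ⊆ insert r (W.erase z), ∀ F ⊆ insert r (W.erase z), E.Nonempty → F.Nonempty →
        Apart G E F → r ∉ E → ∀ v, Bdry G (insert r (W.erase z)) E v → ∃ e ∈ E, G.Adj z e := by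
      intro E hE F hF hne hFne hEF hrE v hv
      by_contra! hcon
      have h1 := hW.2 E (by grind) hne v (fun e he u hu huE heu => by
        have huz : u ≠ z := fun hh => hcon e he (hh ▸ heu.symm)
        exact hv e he u (by grind) huE heu)
      obtain ⟨f, hf⟩ := hFne
      have h2 := fun hh => hEF q hh f hf
      have h3 := @h1 z hz
      have h4 := @h1 f
      have h6 := fun hh => hEF f hh f hf
      have h7 := @h1 q (by grind)
      grind
    have mk : ∀ E ⊆ insert r (W.erase z), ∀ F ⊆ insert r (W.erase z), ∀ H : Finset V,
        E.Nonempty → F.Nonempty → Apart G E F → Apart G E H → Apart G F H → r ∈ H → ∀ v w,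
        Bdry G (insert r (W.erase z)) E v → Bdry G (insert r (W.erase z)) F w → False := by
      intro E hE F hF H hne hFne hEF hEH hFH hrH v w hv hw
      have h1 := fun e he => hEH e he r hrH
      have h2 := fun e he => hFH e he r hrH
      exact hcon ⟨E, F, v, w, by grind, by grind, hne, hFne, fun hh => (h1 q hh).2 hrq.symm,
        fun hh => (h2 q hh).2 hrq.symm, hEF,
        fun e he u hu => hv e he u (by grind), fun e he u hu => hw e he u (by grind)⟩
    intro E₁ h₁ E₂ h₂ E₃ h₃ n₁ n₂ n₃ v₁ v₂ v₃ b₁ b₂ b₃ a₁₂ a₁₃ a₂₃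
    by_cases r₁ : r ∈ E₁
    · exact mk E₂ h₂ E₃ h₃ E₁ n₂ n₃ a₂₃ a₁₂.symm a₁₃.symm r₁ _ _ b₂ b₃
    by_cases r₂ : r ∈ E₂
    · exact mk E₁ h₁ E₃ h₃ E₂ n₁ n₃ a₁₃ a₁₂ a₂₃.symm r₂ _ _ b₁ b₃
    by_cases r₃ : r ∈ E₃
    · exact mk E₁ h₁ E₂ h₂ E₃ n₁ n₂ a₁₂ a₁₃ a₂₃ r₃ _ _ b₁ b₂
    obtain ⟨e₁, m₁, z₁⟩ := adjz E₁ h₁ E₂ h₂ n₁ n₂ a₁₂ r₁ _ b₁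
    obtain ⟨e₂, m₂, z₂⟩ := adjz E₂ h₂ E₁ h₁ n₂ n₁ a₁₂.symm r₂ _ b₂
    obtain ⟨e₃, m₃, z₃⟩ := adjz E₃ h₃ E₁ h₁ n₃ n₁ a₁₃.symm r₃ _ b₃
    have h12 := a₁₂ _ m₁ _ m₂
    have h13 := a₁₃ _ m₁ _ m₃
    have h23 := a₂₃ _ m₂ _ m₃
    have := hG z e₁ e₂ e₃ z₁ z₂ z₃ h12.1 h13.1 h23.1
    tauto
  obtain ⟨A, B, a, b, h, hmax⟩ : ∃ A B a b, Arms G W z q A B a b ∧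
      ∀ A' B' a' b', Arms G W z q A' B' a' b' → A'.card + B'.card ≤ A.card + B.card := by
    obtain ⟨A₀, B₀, a₀, b₀, h₀⟩ := hex
    obtain ⟨⟨A, B⟩, hAB, hmax⟩ := Finset.exists_max_image
      ((W.powerset ×ˢ W.powerset).filter (fun P => ∃ a b, Arms G W z q P.1 P.2 a b))
      (fun P => P.1.card + P.2.card) ⟨(A₀, B₀), by
        have := h₀.subset_left
        have := h₀.subset_right
        simp only [Finset.mem_filter, Finset.mem_product, Finset.mem_powerset]
        exact ⟨⟨by grind, by grind⟩, a₀, b₀, h₀⟩⟩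
    obtain ⟨a, b, h⟩ := (Finset.mem_filter.1 hAB).2
    refine ⟨A, B, a, b, h, fun A' B' a' b' h' => hmax (A', B') ?_⟩
    have := h'.subset_left
    have := h'.subset_right
    simp only [Finset.mem_filter, Finset.mem_product, Finset.mem_powerset]
    exact ⟨⟨by grind, by grind⟩, a', b', h'⟩
  have hDW : insert c W = D := by grind
  obtain ⟨uA, huA, hzA⟩ := h.exists_adj' hW hz hqW
  obtain ⟨uB, huB, hzB⟩ := h.symm.exists_adj' hW hz hqW
  have hAW := h.subset_left
  have hBW := h.subset_right
  have h1 := h.apart uA huA uB huB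
  have hclq' : ∀ x ∈ W, ∀ y ∈ W, G.Adj q x → G.Adj q y → x ≠ y → G.Adj x y :=
    fun x hx y hy => hclq x (by grind) y (by grind)
  have hclc' : ∀ x ∈ W, ∀ y ∈ W, G.Adj c x → G.Adj c y → x ≠ y → G.Adj x y :=
    fun x hx y hy => hclc x (by grind) y (by grind)
  have hpn' : ∀ u ∈ W, ¬ G.Adj p u := fun u hu hpu => by
    have := hpn u
    grind
  -- No claw at `z`, so `c` has a neighbour in one of the arms, and the arms are symmetric.
  have := hG z c uA uB hcz.symm hzA hzB (by grind) (by grind) h1.1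
  rw [← hDW]
  have hcase : G.Adj c uA ∨ G.Adj c uB := by tauto
  rcases hcase with hcu | hcu
  · exact h.tiles hG hW hz hqW hclq' hmax (by grind) hcz hclc' (by grind) hpc hpn' (by grind)
      hrq (by grind) hpr ⟨uA, huA, hzA, hcu⟩ (n := n) (by omega) h3 ih
  · exact h.symm.tiles hG hW hz hqW hclq'
      (fun A' B' a' b' h' => by have := hmax A' B' a' b' h'; omega) (by grind) hcz hclc'
      (by grind) hpc hpn' (by grind)
      hrq (by grind) hpr ⟨uB, huB, hzB, hcu⟩ (n := n) (by omega) h3 ih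

lemma IsCut.not_conn_erase (hcut : IsCut G U A c B) : ¬ Conn G (U.erase c) := by
  intro h
  have hmem := hcut.mem
  have hcA := hcut.notMem_left
  have hcB := hcut.notMem_right
  have hdis := hcut.disjoint
  have := h.2 A (fun x hx => by have := hmem x; grind) hcut.left (fun e he u hu heu => by
    have := hcut.apart e he u
    have := hmem u
    grind)
  obtain ⟨b, hb⟩ := hcut.right
  have := @this b (by have := hmem b; grind)
  grind

lemma IsCut.insert_pendant {q : V} (hcut : IsCut G U A c {p}) (hcut' : IsCut G (insert c A) X q Y)
    (hcX : c ∈ X) : IsCut G U (insert p X) q Y := by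
  have hpb := hcut.symm.bdry p (by simp)
  have hp : p ∉ insert c A := by
    have := hcut.disjoint p
    have := hcut.notMem_right
    grind
  have hm := hcut'.mem
  have hU : U = insert p (insert q (X ∪ Y)) := by
    rw [← hcut'.eq, hcut.eq]
    ext; grind
  have hpY : p ∉ Y := fun hh => hp ((hm p).2 (Or.inr (Or.inr hh)))
  refine ⟨?_, by simp, hcut'.right, ?_, hcut'.notMem_right, ?_⟩
  · rw [hU, Finset.insert_union, Finset.insert_comm]
  · have h1 : q ≠ p := fun hh => hp (hh ▸ (hm q).2 (Or.inl rfl))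
    simp [h1, hcut'.notMem_left]
  · intro e he f hf
    rcases Finset.mem_insert.1 he with rfl | he
    · refine ⟨fun hh => hpY (hh ▸ hf), fun hef => ?_⟩
      have hfU : f ∈ U := by rw [hU]; simp [hf]
      have hfp : f ≠ e := fun hh => hpY (hh ▸ hf)
      have := hpb f hfU (by simpa using hfp) hef
      exact hcut'.disjoint c hcX (this ▸ hf)
    · exact hcut'.apart e he f hf

/-- The aim is a cut vertex of `U` with at least two vertices on each side, where
`Good.tiles_of_cut` applies. The vertex `q` is one unless its far side is a single pendant vertex
`r`. Then either the graph without `p` and `r` has no cut vertex, which is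
`NoCut.tiles_insert_insert`, or a cut vertex `v` of it separates `c` from `q` and is as wanted. -/
lemma Good.tiles_of_pendant_of_mem {q : V} (h : Good G U) (hG : NoClaw G)
    (hcut : IsCut G U A c {p}) (hcut' : IsCut G (insert c A) X q Y) (hcX : c ∈ X) (h3 : 3 ∣ U.card)
    (ih : ∀ W : Finset V, W.card < U.card → Good G W → 3 ∣ W.card → Tiles G W) : Tiles G U := by
  have hcut2 := hcut.insert_pendant hcut' hcX
  have hA := hcut'.mem
  have hcA := hcut.notMem_left
  have hp : p ∉ insert c A := by
    have := hcut.disjoint p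
    have := hcut.notMem_right
    grind
  have hqX := hcut'.notMem_left
  have hqY := hcut'.notMem_right
  have hdXY := hcut'.disjoint
  have hpb := hcut.symm.bdry p (by simp)
  have hXY := hcut'.apart
  simp only [Finset.mem_singleton] at hpb
  have hpX : p ∉ X := fun hh => hp ((hA p).2 (Or.inr (Or.inl hh)))
  have hpY : p ∉ Y := fun hh => hp ((hA p).2 (Or.inr (Or.inr hh)))
  have hpq : p ≠ q := fun hh => hp ((hA p).2 (Or.inl hh))
  have hcq : c ≠ q := ne_of_mem_of_not_mem hcX hqX
  have hg := h.cut_insert_vertex hcut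
  have hgA := h.cut_side hG hcut
  have hadj : G.Adj p c := by
    obtain ⟨b, hb, hcb⟩ := h.1.cut_adj hcut.symm
    rw [Finset.mem_singleton.1 hb] at hcb
    exact hcb.symm
  have hX2 : 2 ≤ (insert p X).card := by
    have := Finset.card_pos.2 ⟨c, hcX⟩
    rw [Finset.card_insert_of_notMem hpX]
    omega
  by_cases hY : 2 ≤ Y.card
  · exact h.tiles_of_cut hG hcut2 h3 (fun _ => ⟨hX2, hY⟩) ih
  obtain ⟨r, rfl⟩ : ∃ r, Y = {r} := Finset.card_eq_one.1 (by
    have := hcut'.right.card_pos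
    omega)
  have hrb := hcut'.symm.bdry r (by simp)
  simp only [Finset.mem_singleton] at hqY hdXY hrb hpY
  have hradj : G.Adj r q := by
    obtain ⟨b, hb, hcb⟩ := hg.1.cut_adj hcut'.symm
    rw [Finset.mem_singleton.1 hb] at hcb
    exact hcb.symm
  have hcr : c ≠ r := hdXY c hcX
  have hrX : r ∉ X := fun hh => hdXY r hh rfl
  have hrq : r ≠ q := fun hh => hqY hh.symm
  have hclc := h.1.cut_clique hG hcut
  have hclq := hg.1.cut_clique hG hcut'
  have hUeq : U = insert p (insert r (insert q X)) := by
    rw [hcut2.eq, Finset.union_comm, Finset.singleton_union, Finset.insert_comm r p,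
      Finset.insert_comm q p, Finset.insert_comm q r]
  have hmA : ∀ x ∈ insert q X, x ≠ c → x ∈ A := by
    intro x hx hxc
    refine Finset.mem_of_mem_insert_of_ne ((hA x).2 ?_) hxc
    rcases Finset.mem_insert.1 hx with hx | hx
    · exact Or.inl hx
    · exact Or.inr (Or.inl hx)
  have hgD := hg.cut_insert_vertex hcut'
  have hDc : (insert q X).card + 2 = U.card := by
    have h1 : p ∉ insert r (insert q X) := by simp [hpX, hpq, hpY]
    have h2 : r ∉ insert q X := by simp [hrX, hrq]
    rw [hUeq, Finset.card_insert_of_notMem h1, Finset.card_insert_of_notMem h2]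
  have hpn : ∀ u ∈ insert q X, G.Adj p u → u = c := by
    intro u hu hpu
    exact hpb u (by rw [hUeq]; exact Finset.mem_insert_of_mem (Finset.mem_insert_of_mem hu))
      hpu.ne.symm hpu
  have hrn : ∀ u ∈ insert q X, G.Adj r u → u = q := by
    intro u hu hru
    refine hrb u ((hA u).2 ?_) hru.ne.symm hru
    rcases Finset.mem_insert.1 hu with hx | hx
    · exact Or.inl hx
    · exact Or.inr (Or.inl hx)
  by_cases hD : NoCut G (insert q X)
  · rw [hUeq]
    refine hD.tiles_insert_insert hG (c := c) (q := q) (n := U.card) (by simp [hcX]) (by simp) hcq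
      (fun x hx y hy hcx hcy => hclc x (hmA x hx hcx.ne.symm) y (hmA y hy hcy.ne.symm) hcx hcy)
      (fun x hx y hy hqx hqy => hclq x ?_ y ?_ hqx hqy) (by simp [hpX, hpq]) hadj hpn
      (by simp [hrX, hrq]) hradj hrn hpY hDc.symm h3 ih
    · have := hqx.ne.symm
      simpa [this] using hx
    · have := hqy.ne.symm
      simpa [this] using hy
  obtain ⟨P, v, Q, hPQ⟩ := exists_isCut hgD.1 hD
  have hmem := hPQ.mem
  -- Deleting `c` from `insert q X` leaves `A - r`, which is connected since `A` is and `r` has only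
  -- the neighbour `q` in it.
  have hvc : v ≠ c := by
    rintro rfl
    refine hPQ.not_conn_erase ?_
    have hrA : r ∈ A := Finset.mem_of_mem_insert_of_ne ((hA r).2 (by simp)) hcr.symm
    have hqA : q ∈ A := Finset.mem_of_mem_insert_of_ne ((hA q).2 (by simp)) hcq.symm
    have := hgA.1.erase hrA (fun a ha b hb hra hrb' hab => by
      have h1 := hrb a (by simp [ha]) hra.ne.symm hra
      have h2 := hrb b (by simp [hb]) hrb'.ne.symm hrb'
      exact (hab (h1.trans h2.symm)).elim) ⟨q, Finset.mem_erase.2 ⟨hqY, hqA⟩⟩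
    have heq : (insert q X).erase v = A.erase r := by
      rw [← Finset.erase_insert hcA, Finset.erase_right_comm, hcut'.eq]
      congr 1
      ext x
      simp only [Finset.mem_erase, Finset.mem_insert, Finset.mem_union, Finset.mem_singleton]
      constructor
      · rintro (rfl | hx)
        · exact ⟨hqY, Or.inl rfl⟩
        · exact ⟨hdXY x hx, Or.inr (Or.inl hx)⟩
      · rintro ⟨hxr, hx | hx | hx⟩
        · exact Or.inl hx
        · exact Or.inr hx
        · exact (hxr hx).elim
    rwa [heq]
  have hvq : v ≠ q := by
    rintro rfl
    refine hPQ.not_conn_erase ?_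
    rw [Finset.erase_insert hqX]
    exact (hg.cut_side hG hcut').1
  wlog hcP : c ∈ P generalizing P Q
  · refine this Q P hPQ.symm hPQ.symm.mem ?_
    rcases (hmem c).1 (by simp [hcX]) with hh | hh | hh
    · exact (hvc hh.symm).elim
    · exact (hcP hh).elim
    · exact hh
  have hvU : ∀ x ∈ insert q X, x ∈ U := fun x hx => by
    rw [hUeq]; exact Finset.mem_insert_of_mem (Finset.mem_insert_of_mem hx)
  have hpD : p ∉ insert q X := by simp [hpX, hpq]
  have hrD : r ∉ insert q X := by simp [hrX, hrq]
  have hPD : ∀ x ∈ P, x ∈ insert q X := fun x hx => (hmem x).2 (Or.inr (Or.inl hx))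
  have hQD : ∀ x ∈ Q, x ∈ insert q X := fun x hx => (hmem x).2 (Or.inr (Or.inr hx))
  have hvD : v ∈ insert q X := (hmem v).2 (Or.inl rfl)
  have hpr : ¬ G.Adj p r := fun hh => hcr (hpb r (by rw [hUeq]; simp) (Ne.symm hpY) hh).symm
  have hpQ : ∀ u ∈ Q, p ≠ u ∧ ¬ G.Adj p u := fun u hu =>
    ⟨fun hh => hpD (hh ▸ hQD u hu), fun hh => hPQ.disjoint c hcP (hpn u (hQD u hu) hh ▸ hu)⟩
  have hqPQ : q ∈ P ∨ q ∈ Q := by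
    rcases (hmem q).1 (by simp) with hh | hh
    · exact (hvq hh.symm).elim
    · exact hh
  -- With `c` and `q` on the same side of `v`, the sets `{p}`, `{r}` and `Q` are three separated
  -- end-pieces. On different sides, `p` and `r` bring both sides to at least two vertices.
  rcases hqPQ with hqP | hqQ
  · have hrQ : ∀ u ∈ Q, r ≠ u ∧ ¬ G.Adj r u := fun u hu =>
      ⟨fun hh => hrD (hh ▸ hQD u hu), fun hh => hPQ.disjoint q hqP (hrn u (hQD u hu) hh ▸ hu)⟩
    have b1 : Bdry G U {p} c := hcut.symm.bdry
    have b2 : Bdry G U {r} q := hcut2.symm.bdry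
    have b3 : Bdry G U Q v := by
      intro e he u hu huQ heu
      rw [hUeq, Finset.mem_insert, Finset.mem_insert] at hu
      rcases hu with rfl | rfl | hu
      · exact ((hpQ e he).2 heu.symm).elim
      · exact ((hrQ e he).2 heu.symm).elim
      · exact hPQ.symm.bdry e he u hu huQ heu
    refine (h.2 {p} ?_ {r} ?_ Q (fun x hx => hvU x (hQD x hx)) (by simp) (by simp) hPQ.right c q v
      b1 b2 b3 ?_ ?_ ?_).elim
    · rw [hUeq]; simp
    · rw [hUeq]; simp
    · intro e he f hf
      rw [Finset.mem_singleton.1 he, Finset.mem_singleton.1 hf]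
      exact ⟨hpY, hpr⟩
    · intro e he f hf
      rw [Finset.mem_singleton.1 he]
      exact hpQ f hf
    · intro e he f hf
      rw [Finset.mem_singleton.1 he]
      exact hrQ f hf
  · have hrP : ∀ u ∈ P, r ≠ u ∧ ¬ G.Adj r u := fun u hu =>
      ⟨fun hh => hrD (hh ▸ hPD u hu), fun hh => hPQ.disjoint u hu (hrn u (hPD u hu) hh ▸ hqQ)⟩
    have hcut3 : IsCut G U (insert p P) v (insert r Q) := by
      refine ⟨?_, by simp, by simp, ?_, ?_, ?_⟩
      · rw [hUeq, hPQ.eq, Finset.insert_union, Finset.union_insert, Finset.insert_comm v p,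
          Finset.insert_comm v r]
      · have : v ≠ p := fun hh => hpD (hh ▸ hvD)
        simp [this, hPQ.notMem_left]
      · have : v ≠ r := fun hh => hrD (hh ▸ hvD)
        simp [this, hPQ.notMem_right]
      · intro e he f hf
        rcases Finset.mem_insert.1 he with rfl | he <;> rcases Finset.mem_insert.1 hf with rfl | hf
        · exact ⟨hpY, hpr⟩
        · exact hpQ f hf
        · exact ⟨(hrP e he).1.symm, fun hh => (hrP e he).2 hh.symm⟩
        · exact hPQ.apart e he f hf
    refine h.tiles_of_cut hG hcut3 h3 (fun _ => ⟨?_, ?_⟩) ih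
    · have := hPQ.left.card_pos
      rw [Finset.card_insert_of_notMem (fun hh => hpD (hPD p hh))]
      omega
    · have := hPQ.right.card_pos
      rw [Finset.card_insert_of_notMem (fun hh => hrD (hQD r hh))]
      omega

/-- If `insert c A` has no cut vertex, neither has `A`, because `c` is simplicial there. So the path
`p`, `c`, `a` can be removed. Otherwise a cut vertex of `insert c A` leads to the previous lemma. -/
lemma Good.tiles_of_pendant (h : Good G U) (hG : NoClaw G) (hcut : IsCut G U A c {p})
    (h3 : 3 ∣ U.card)
    (ih : ∀ W : Finset V, W.card < U.card → Good G W → 3 ∣ W.card → Tiles G W) : Tiles G U := by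
  have hcard := hcut.card
  rw [Finset.card_singleton] at hcard
  have hcA := hcut.notMem_left
  have hpA : p ∉ A := fun hh => hcut.disjoint p hh (by simp)
  have hcp : c ≠ p := fun hh => hcut.notMem_right (by simp [hh])
  obtain ⟨a, ha, hca⟩ := h.1.cut_adj hcut
  have hadj : G.Adj p c := by
    obtain ⟨b, hb, hcb⟩ := h.1.cut_adj hcut.symm
    rw [Finset.mem_singleton.1 hb] at hcb
    exact hcb.symm
  have key : Tiles G (A.erase a) → Tiles G U := fun hT =>
    hT.of_eq_union (Tiles.path hadj hca (by grind)) (by grind)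
      (fun x => by rw [hcut.mem]; grind)
  have hca' := Finset.card_erase_of_mem ha
  have hgA := h.cut_side hG hcut
  by_cases hA1 : A.card = 1
  · apply key
    have : A.erase a = ∅ := Finset.card_eq_zero.1 (by omega)
    rw [this]
    exact Tiles.empty
  by_cases hn : NoCut G (insert c A)
  · have hclc := h.1.cut_clique hG hcut
    have hnA := hn.erase (v := c) (by simp) (fun x hx y hy hcx hcy hxy => by
      have := hcx.ne
      have := hcy.ne
      grind) (by rw [Finset.erase_insert hcA]; exact ⟨a, ha⟩)
    rw [Finset.erase_insert hcA] at hnA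
    have hp := hcut.left.card_pos
    have hgood := hnA.good_erase_cut hG ha (Finset.card_pos.1 (by omega))
    exact key (ih _ (by omega) hgood (by omega))
  · have hg := h.cut_insert_vertex hcut
    obtain ⟨X, q, Y, hcut'⟩ := exists_isCut hg.1 hn
    have hcq : c ≠ q := by
      rintro rfl
      refine hcut'.not_conn_erase ?_
      rw [Finset.erase_insert hcA]
      exact hgA.1
    have := (hcut'.mem c).1 (by simp)
    rcases this with hh | hh | hh
    · exact (hcq hh).elim
    · exact h.tiles_of_pendant_of_mem hG hcut hcut' hh h3 ih
    · exact h.tiles_of_pendant_of_mem hG hcut hcut'.symm hh h3 ih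

/-- A connected claw-free graph with at most two end-blocks whose number of vertices is divisible
by three can be partitioned into paths with three vertices. -/
theorem Good.tiles (hG : NoClaw G) (U : Finset V) (h : Good G U) (h3 : 3 ∣ U.card) :
    Tiles G U := by
  induction hn : U.card using Nat.strong_induction_on generalizing U with
  | _ n ih =>
    subst hn
    have ih' : ∀ W : Finset V, W.card < U.card → Good G W → 3 ∣ W.card → Tiles G W :=
      fun W hW hg h3 => ih W.card hW W hg h3 rfl
    by_cases hnc : NoCut G U
    · exact hnc.tiles hG h3 ih'
    obtain ⟨A, c, B, hcut⟩ := exists_isCut h.1 hnc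
    have hA := hcut.left.card_pos
    have hB := hcut.right.card_pos
    by_cases h1 : A.card = 1
    · obtain ⟨p, rfl⟩ := Finset.card_eq_one.1 h1
      exact h.tiles_of_pendant hG hcut.symm h3 ih'
    by_cases h2 : B.card = 1
    · obtain ⟨p, rfl⟩ := Finset.card_eq_one.1 h2
      exact h.tiles_of_pendant hG hcut h3 ih'
    exact h.tiles_of_cut hG hcut h3 (fun _ => ⟨by omega, by omega⟩) ih'

/-! ### End-blocks after deleting a vertex of a 2-connected graph -/

lemma Conn.union (hX : Conn G X) (hY : Conn G Y) (hcX : c ∈ X) (hcY : c ∈ Y) :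
    Conn G (X ∪ Y) := by
  refine ⟨⟨c, by simp [hcX]⟩, fun E hE hne hc => ?_⟩
  have sub : ∀ Z ⊆ X ∪ Y, Conn G Z → (∃ e ∈ E, e ∈ Z) → Z ⊆ E := by
    rintro Z hZ hcZ ⟨e, he, heZ⟩
    have := hcZ.2 (E ∩ Z) Finset.inter_subset_right ⟨e, by simp [he, heZ]⟩ (fun f hf u hu hfu => by
      simp only [Finset.mem_inter] at hf ⊢
      exact ⟨hc f hf.1 u (hZ hu) hfu, hu⟩)
    exact this.trans Finset.inter_subset_left
  obtain ⟨e, he⟩ := hne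
  have hXs := sub X Finset.subset_union_left hX
  have hYs := sub Y Finset.subset_union_right hY
  rcases Finset.mem_union.1 (hE he) with heX | heY
  · have h1 := hXs ⟨e, he, heX⟩
    exact Finset.union_subset h1 (hYs ⟨c, h1 hcX, hcY⟩)
  · have h1 := hYs ⟨e, he, heY⟩
    exact Finset.union_subset (hXs ⟨c, h1 hcY, hcX⟩) h1

/-- Inside every side of a cut vertex there is an end-block. -/
lemma Good.exists_end_block (h : Good G U) (hG : NoClaw G) (hcut : IsCut G U A c B) :
    ∃ A' ⊆ A, ∃ c' B', IsCut G U A' c' B' ∧ NoCut G (insert c' A') := by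
  induction hn : A.card using Nat.strong_induction_on generalizing A c B with
  | _ n ih =>
    by_cases hA : NoCut G (insert c A)
    · exact ⟨A, subset_rfl, c, B, hcut, hA⟩
    have hg := h.cut_insert_vertex hcut
    obtain ⟨X, v, Y, hXY⟩ := exists_isCut hg.1 hA
    have hcA := hcut.notMem_left
    have hvc : c ≠ v := by
      rintro rfl
      refine hXY.not_conn_erase ?_
      rw [Finset.erase_insert hcA]
      exact (h.cut_side hG hcut).1
    wlog hcX : c ∈ X generalizing X Y
    · refine this Y X hXY.symm ?_
      rcases (hXY.mem c).1 (by simp) with hh | hh | hh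
      · exact (hvc hh).elim
      · exact (hcX hh).elim
      · exact hh
    have hcY : c ∉ Y := hXY.disjoint c hcX
    have hYA : Y ⊆ A := fun y hy => Finset.mem_of_mem_insert_of_ne
      ((hXY.mem y).2 (Or.inr (Or.inr hy))) (fun hh => hcY (hh ▸ hy))
    have hvA : v ∈ A := Finset.mem_of_mem_insert_of_ne ((hXY.mem v).2 (Or.inl rfl)) hvc.symm
    -- The side of `v` away from `c` is also a side of `v` in `U`, and it is smaller than `A`.
    have hcut' : IsCut G U Y v (X ∪ B) := by
      refine ⟨?_, hXY.right, hXY.left.mono Finset.subset_union_left, hXY.notMem_right, ?_, ?_⟩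
      · rw [hcut.eq, ← Finset.insert_union, hXY.eq, Finset.insert_union, Finset.union_comm X Y,
          Finset.union_assoc]
      · simp [hXY.notMem_left, hcut.disjoint v hvA]
      · intro e he f hf
        rcases Finset.mem_union.1 hf with hf | hf
        · exact hXY.symm.apart e he f hf
        · exact hcut.apart e (hYA he) f hf
    obtain ⟨A', hA', c', B', h1, h2⟩ := ih Y.card (by
      rw [← hn]
      exact Finset.card_lt_card ⟨hYA, fun hh => hXY.notMem_right (hh hvA)⟩) hcut' rfl
    exact ⟨A', hA'.trans hYA, c', B', h1, h2⟩

lemma NoCut.exists_cut_adj (h : NoCut G U) (hy : y ∈ U) (hcut : IsCut G (U.erase y) A c B) :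
    ∃ a ∈ A, G.Adj y a := by
  have hmem := hcut.mem
  obtain ⟨e, he, u, hu, huA, huc, heu⟩ := h.exists_adj (E := A) (x := y) (v := c)
    (fun x hx => by have := hmem x; grind) hcut.left hy (by have := hmem y; grind)
    (by have := hmem c; grind)
  have hu : u = y := by
    have := hcut.apart e he u
    have := hmem u
    grind
  exact ⟨e, he, hu ▸ heu.symm⟩

/-- The end-block without `z` is still connected and shares `c` with the rest. -/
lemma IsCut.conn_erase (hcut : IsCut G U A c B) (hA : NoCut G (insert c A))
    (hB : Conn G (insert c B)) (hz : z ∈ A) : Conn G (U.erase z) := by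
  have hzc : c ≠ z := fun hh => hcut.notMem_left (hh ▸ hz)
  have hzB := hcut.disjoint z hz
  have hc : c ∈ (insert c A).erase z := by simp [hzc]
  have := (hA.conn_erase ⟨c, hc⟩).union hB hc (by simp)
  convert this using 1
  ext x
  have := hcut.mem x
  simp only [Finset.mem_erase, Finset.mem_union, Finset.mem_insert]
  grind

/-- A piece containing the cut vertex cannot avoid vertices on both sides. -/
lemma Bdry.false_of_cut {P Q : Finset V} (hP : Conn G P) (hQ : Conn G Q) (hPU : P ⊆ U) (hQU : Q ⊆ U)
    (hv : Bdry G U E v) (hc : c ∈ E) (hcP : c ∈ P) (hcQ : c ∈ Q)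
    (hPQ : ∀ x ∈ P, x ∈ Q → x = c) (ha : ∃ a ∈ P, a ∉ E) (hb : ∃ b ∈ Q, b ∉ E) : False := by
  have key : ∀ R ⊆ U, Conn G R → c ∈ R → (∃ a ∈ R, a ∉ E) → v ∈ R ∧ v ∉ E := by
    rintro R hRU hR hcR ⟨a, ha, haE⟩
    obtain ⟨e, he, u, hu, huE, heu⟩ := hR.exists_adj (E := E ∩ R) Finset.inter_subset_right
      ⟨c, by simp [hc, hcR]⟩ ha (by simp [haE])
    have huE' : u ∉ E := fun hh => huE (by simp [hh, hu])
    have := hv e (Finset.mem_inter.1 he).1 u (hRU hu) huE' heu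
    exact this ▸ ⟨hu, huE'⟩
  have h1 := key P hPU hP hcP ha
  have h2 := key Q hQU hQ hcQ hb
  exact h1.2 (hPQ v h1.1 h2.1 ▸ hc)

/-- If `z` is a neighbour of `c` in an end-block of `W - x` with cut vertex `c`,
then `W - x - z` has at most two end-blocks. -/
lemma NoCut.good_erase_erase (h : NoCut G W) (hG : NoClaw G) (hx : x ∈ W)
    (hcut : IsCut G (W.erase x) A c B) (hA : NoCut G (insert c A)) (hz : z ∈ A)
    (hcz : G.Adj c z) : Good G ((W.erase x).erase z) := by
  have hg := h.good_erase_cut hG hx ⟨c, (hcut.mem c).2 (Or.inl rfl)⟩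
  have hB := (hg.cut_insert_vertex hcut.symm).1
  have hmem := hcut.mem
  have hcA := hcut.notMem_left
  have hcB := hcut.notMem_right
  have hAB := hcut.apart
  have hdis := hcut.disjoint
  have hclB := h.cut_clique hG hx hcut.symm
  have hclL := hg.1.cut_clique hG hcut
  have hP := hA.conn_erase (z := z) ⟨c, by have := hcz.ne; grind⟩
  have hcne := hcz.ne
  have hac := G.adj_comm
  refine ⟨hcut.conn_erase hA hB hz, ?_⟩
  have AA : ∀ E ⊆ (W.erase x).erase z, ∀ F ⊆ (W.erase x).erase z, c ∉ E → c ∉ F →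
      (∃ e ∈ E, e ∈ A) → (∃ f ∈ F, f ∈ A) → Apart G E F → ∀ v w,
      Bdry G ((W.erase x).erase z) E v → Bdry G ((W.erase x).erase z) F w → False := by
    -- Otherwise `E ∩ A` would be an end-piece of the end-block avoiding both `z` and `c`.
    have adjz : ∀ E ⊆ (W.erase x).erase z, c ∉ E → (∃ e ∈ E, e ∈ A) → ∀ v,
        Bdry G ((W.erase x).erase z) E v → ∃ e ∈ E, e ∈ A ∧ G.Adj z e := by
      rintro E hE hcE ⟨e, he, heA⟩ v hv
      by_contra! hcon
      have := hA.2 (E ∩ A) (by grind) ⟨e, by grind⟩ v (fun f hf u hu huE hfu => by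
        have h1 := hcon f
        have h2 := hv f (by grind) u
        have := hmem u
        grind)
      have h1 := @this z (by grind)
      have h2 := @this c (by grind)
      grind
    -- If `E` contains a neighbour of `c` in `A`, its boundary vertex is `c`. The neighbours of `c`
    -- in `A` form a clique, so `E ∩ A` with `c` is closed in the end-block minus `z`. It therefore
    -- fills it and leaves no room for `F` there.
    have step : ∀ E ⊆ (W.erase x).erase z, ∀ F : Finset V, c ∉ E → c ∉ F → Apart G E F →
        (∃ f ∈ F, f ∈ A ∧ f ≠ z) → ∀ v, Bdry G ((W.erase x).erase z) E v →
        (∃ e ∈ E, e ∈ A ∧ G.Adj c e) → False := by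
      rintro E hE F hcE hcF hEF ⟨f, hf, hfA, hfz⟩ v hv ⟨e, he, heA, hce⟩
      have hvc : c = v := hv e he c (by have := hmem c; grind) hcE hce.symm
      subst hvc
      have := hP.2 (insert c (E ∩ A)) (by grind) ⟨c, by simp⟩ (fun g hg u hu hgu => by
        have h0 := hmem u
        rcases Finset.mem_insert.1 hg with rfl | hg
        · have h1 := hclL e heA u
          have h2 := hv e he u
          have := hgu.ne
          grind
        · have h2 := hv g (by grind) u
          grind)
      have h1 := @this f (by grind)
      have h2 := fun hh => hEF f hh f hf
      grind
    intro E hE F hF hcE hcF hEA hFA hEF v w hv hw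
    obtain ⟨e, he, heA, hze⟩ := adjz E hE hcE hEA v hv
    obtain ⟨f, hf, hfA, hzf⟩ := adjz F hF hcF hFA w hw
    have hef := hEF e he f hf
    have := hG z c e f hcz.symm hze hzf (by grind) (by grind) hef.1
    rcases this with hh | hh | hh
    · exact step E hE F hcE hcF hEF ⟨f, hf, hfA, hzf.ne.symm⟩ v hv ⟨e, he, heA, hh⟩
    · exact step F hF E hcF hcE hEF.symm ⟨e, he, heA, hze.ne.symm⟩ w hw ⟨f, hf, hfA, hh⟩
    · exact hef.2 hh
  have BB : ∀ E ⊆ (W.erase x).erase z, ∀ F ⊆ (W.erase x).erase z, c ∉ E → c ∉ F →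
      (∃ e ∈ E, e ∈ B) → (∃ f ∈ F, f ∈ B) → Apart G E F → ∀ v w,
      Bdry G ((W.erase x).erase z) E v → Bdry G ((W.erase x).erase z) F w → False := by
    -- Otherwise `E ∩ B` would be an end-piece of `W` avoiding both `x` and `z`.
    have adjx : ∀ E ⊆ (W.erase x).erase z, c ∉ E → (∃ e ∈ E, e ∈ B) → ∀ v,
        Bdry G ((W.erase x).erase z) E v → ∃ e ∈ E, e ∈ B ∧ G.Adj x e := by
      rintro E hE hcE ⟨e, he, heB⟩ v hv
      by_contra! hcon
      have hzW := hmem z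
      have := h.2 (E ∩ B) (by grind) ⟨e, by grind⟩ v (fun f hf u hu huE hfu => by
        have h1 := hcon f
        have h2 := hv f (by grind) u
        have h3 := hmem u
        have h4 := hAB u
        grind)
      have h1 := @this z (by grind)
      have h2 := @this x hx
      grind
    intro E hE F hF hcE hcF hEA hFA hEF v w hv hw
    obtain ⟨e, he, heB, hxe⟩ := adjx E hE hcE hEA v hv
    obtain ⟨f, hf, hfB, hxf⟩ := adjx F hF hcF hFA w hw
    have hef := hEF e he f hf
    exact hef.2 (hclB e heB f hfB hxe hxf hef.1)
  have AorB : ∀ E ⊆ (W.erase x).erase z, c ∉ E → E.Nonempty →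
      (∃ e ∈ E, e ∈ A) ∨ ∃ e ∈ E, e ∈ B := by
    rintro E hE hcE ⟨e, he⟩
    have := hmem e
    grind
  -- If `H` contains `c`, the other two pieces either meet the same side, excluded by `AA` and `BB`,
  -- or show that `H` misses vertices on both sides.
  have pair : ∀ E ⊆ (W.erase x).erase z, ∀ F ⊆ (W.erase x).erase z, ∀ H ⊆ (W.erase x).erase z,
      c ∈ H → E.Nonempty → F.Nonempty → Apart G E F → Apart G E H → Apart G F H → ∀ v w t,
      Bdry G ((W.erase x).erase z) E v → Bdry G ((W.erase x).erase z) F w →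
      Bdry G ((W.erase x).erase z) H t → False := by
    intro E hE F hF H hH hcH hne hnf hEF hEH hFH v w t hv hw ht
    have hcE : c ∉ E := fun hh => (hEH c hh c hcH).1 rfl
    have hcF : c ∉ F := fun hh => (hFH c hh c hcH).1 rfl
    have cross : (∃ e, e ∉ H ∧ e ∈ A ∧ e ≠ z) → (∃ e, e ∉ H ∧ e ∈ B) → False := by
      rintro ⟨a, haH, haA, haz⟩ ⟨b, hbH, hbB⟩
      exact Bdry.false_of_cut hP hB (fun u hu => by have := hmem u; grind)
        (fun u hu => by have := hmem u; grind) ht hcH (by grind) (by simp) (by grind)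
        ⟨a, by grind, haH⟩ ⟨b, by grind, hbH⟩
    have oA : ∀ E ⊆ (W.erase x).erase z, Apart G E H → (∃ e ∈ E, e ∈ A) →
        ∃ e, e ∉ H ∧ e ∈ A ∧ e ≠ z := by
      rintro E hE hEH ⟨e, he, heA⟩
      exact ⟨e, fun hh => (hEH e he e hh).1 rfl, heA, by grind⟩
    have oB : ∀ E ⊆ (W.erase x).erase z, Apart G E H → (∃ e ∈ E, e ∈ B) → ∃ e, e ∉ H ∧ e ∈ B := by
      rintro E hE hEH ⟨e, he, heB⟩
      exact ⟨e, fun hh => (hEH e he e hh).1 rfl, heB⟩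
    rcases AorB E hE hcE hne with h1 | h1 <;> rcases AorB F hF hcF hnf with h2 | h2
    · exact AA E hE F hF hcE hcF h1 h2 hEF v w hv hw
    · exact cross (oA E hE hEH h1) (oB F hF hFH h2)
    · exact cross (oA F hF hFH h2) (oB E hE hEH h1)
    · exact BB E hE F hF hcE hcF h1 h2 hEF v w hv hw
  intro E₁ h₁ E₂ h₂ E₃ h₃ n₁ n₂ n₃ v₁ v₂ v₃ b₁ b₂ b₃ a₁₂ a₁₃ a₂₃
  by_cases c₁ : c ∈ E₁
  · exact pair E₂ h₂ E₃ h₃ E₁ h₁ c₁ n₂ n₃ a₂₃ a₁₂.symm a₁₃.symm _ _ _ b₂ b₃ b₁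
  by_cases c₂ : c ∈ E₂
  · exact pair E₁ h₁ E₃ h₃ E₂ h₂ c₂ n₁ n₃ a₁₃ a₁₂ a₂₃.symm _ _ _ b₁ b₃ b₂
  by_cases c₃ : c ∈ E₃
  · exact pair E₁ h₁ E₂ h₂ E₃ h₃ c₃ n₁ n₂ a₁₂ a₁₃ a₂₃ _ _ _ b₁ b₂ b₃
  have o₁ := AorB E₁ h₁ c₁ n₁
  have o₂ := AorB E₂ h₂ c₂ n₂
  have o₃ := AorB E₃ h₃ c₃ n₃
  have A₁₂ := fun i j => AA E₁ h₁ E₂ h₂ c₁ c₂ i j a₁₂ _ _ b₁ b₂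
  have A₁₃ := fun i j => AA E₁ h₁ E₃ h₃ c₁ c₃ i j a₁₃ _ _ b₁ b₃
  have A₂₃ := fun i j => AA E₂ h₂ E₃ h₃ c₂ c₃ i j a₂₃ _ _ b₂ b₃
  have B₁₂ := fun i j => BB E₁ h₁ E₂ h₂ c₁ c₂ i j a₁₂ _ _ b₁ b₂
  have B₁₃ := fun i j => BB E₁ h₁ E₃ h₃ c₁ c₃ i j a₁₃ _ _ b₁ b₃
  have B₂₃ := fun i j => BB E₂ h₂ E₃ h₃ c₂ c₃ i j a₂₃ _ _ b₂ b₃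
  rcases o₁ with o₁ | o₁ <;> rcases o₂ with o₂ | o₂ <;> rcases o₃ with o₃ | o₃ <;>
    first
      | exact A₁₂ o₁ o₂
      | exact A₁₃ o₁ o₃
      | exact A₂₃ o₂ o₃
      | exact B₁₂ o₁ o₂
      | exact B₁₃ o₁ o₃
      | exact B₂₃ o₂ o₃

/-! ### The auxiliary graph with a pendant vertex -/

/-- The graph obtained from `G` by deleting the edges from `x` to vertices outside `K` and adding
a pendant vertex at `x`. -/
def pendantAt (G : SimpleGraph V) (x : V) (K : Finset V) : SimpleGraph (Option V) where
  Adj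
    | none, none => False
    | none, some v => v = x
    | some u, none => u = x
    | some u, some v => G.Adj u v ∧ (u = x → v ∈ K) ∧ (v = x → u ∈ K)
  symm := ⟨by
    rintro (_ | u) (_ | v) h
    · exact h
    · exact h
    · exact h
    · exact ⟨h.1.symm, h.2.2, h.2.1⟩⟩
  loopless := ⟨by
    rintro (_ | u) h
    · exact h
    · exact h.1.ne rfl⟩

@[simp] lemma pendantAt_none_none {K : Finset V} : ¬ (pendantAt G x K).Adj none none := id

@[simp] lemma pendantAt_none_some {K : Finset V} :
    (pendantAt G x K).Adj none (some v) ↔ v = x := Iff.rfl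

@[simp] lemma pendantAt_some_none {K : Finset V} :
    (pendantAt G x K).Adj (some v) none ↔ v = x := Iff.rfl

@[simp] lemma pendantAt_some_some {K : Finset V} : (pendantAt G x K).Adj (some a) (some b) ↔
    G.Adj a b ∧ (a = x → b ∈ K) ∧ (b = x → a ∈ K) := Iff.rfl

/-- At `x` the neighbours are the clique `K` and the pendant vertex. A new claw at another vertex
`a` would need a deleted edge from `x` to some `t` between two leaves. Then `a ∈ K` is adjacent to
`t`, and `hKx` puts `t` in `K`, so the edge was not deleted. -/
lemma pendantAt_noClaw {K : Finset V} (hG : NoClaw G)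
    (hK : ∀ a ∈ K, ∀ b ∈ K, a ≠ b → G.Adj a b) (hxK : x ∉ K)
    (hKx : ∀ w ∈ K, G.Adj x w → ∀ t, G.Adj w t → G.Adj x t → t ∈ K) :
    NoClaw (pendantAt G x K) := by
  have hac := G.adj_comm
  have hne := fun a b => G.ne_of_adj (a := a) (b := b)
  rintro (_ | a) (_ | b) (_ | c) (_ | d) hab hac' had hbc hbd hcd <;>
    simp only [pendantAt_none_none, pendantAt_none_some, pendantAt_some_none, pendantAt_some_some,
      ne_eq, Option.some.injEq, not_true_eq_false, reduceCtorEq, not_false_eq_true] at *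
  all_goals try grind
  have h1 := hG a b c d hab.1 hac'.1 had.1 hbc hbd hcd
  have h2 := hKx a
  clear hG hKx
  grind

lemma Tiles.eraseNone {K : Finset V} {T : Finset (Option V)} (h : Tiles (pendantAt G x K) T)
    (hT : none ∉ T) : Tiles G (Finset.eraseNone T) := by
  induction h with
  | empty => simpa using Tiles.empty
  | @step U a b c hU hab hbc hac ha hb hc ih =>
    simp only [Finset.mem_insert, not_or] at hT
    obtain ⟨a, rfl⟩ := Option.ne_none_iff_exists'.1 (Ne.symm hT.1)
    obtain ⟨b, rfl⟩ := Option.ne_none_iff_exists'.1 (Ne.symm hT.2.1)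
    obtain ⟨c, rfl⟩ := Option.ne_none_iff_exists'.1 (Ne.symm hT.2.2.1)
    have := Tiles.step (ih hT.2.2.2) hab.1 hbc.1 (by simpa using hac) (by simpa using ha)
      (by simpa using hb) (by simpa using hc)
    convert this using 1
    ext; simp

lemma Conn.pendantAt {K : Finset V} (h : Conn G U) (hx : x ∉ U) :
    Conn (pendantAt G x K) (U.map Function.Embedding.some) := by
  refine ⟨by simpa using h.1, fun E hE hne hc => ?_⟩
  have hE' : ∀ e ∈ E, ∃ u ∈ U, e = some u := by
    intro e he
    obtain ⟨u, hu, rfl⟩ := Finset.mem_map.1 (hE he)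
    exact ⟨u, hu, rfl⟩
  have := h.2 (Finset.eraseNone E) (fun u hu => by
      obtain ⟨w, hw, hh⟩ := hE' _ (Finset.mem_eraseNone.1 hu)
      cases hh
      exact hw) (by
      obtain ⟨e, he⟩ := hne
      obtain ⟨w, hw, rfl⟩ := hE' e he
      exact ⟨w, by simpa using he⟩) (fun e he u hu heu => by
      rw [Finset.mem_eraseNone] at he ⊢
      refine hc _ he _ (by simpa using hu) ?_
      obtain ⟨w, hw, hh⟩ := hE' _ he
      cases hh
      refine ⟨heu, fun hh => (hx (hh ▸ hw)).elim, fun hh => (hx (hh ▸ hu)).elim⟩)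
  intro e he
  obtain ⟨u, hu, rfl⟩ := Finset.mem_map.1 he
  exact Finset.mem_eraseNone.1 (this hu)

/-- Of three separated end-pieces two avoid the pendant vertex. Each of these avoids `x` and `K`, so
it contains a neighbour of `x` in `insert c B`; two such pieces cannot be separated. -/
lemma NoCut.good_pendantAt {K : Finset V} (h : NoCut G W) (hG : NoClaw G) (hx : x ∈ W)
    (hcut : IsCut G (W.erase x) A c B) (hKA : K ⊆ A) (hK : ∀ u, u ∈ K ↔ u ∈ A ∧ G.Adj x u) :
    Good (pendantAt G x K) (insert none (insert (some x) ((W.erase x).map .some))) := by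
  have hg := h.good_erase_cut hG hx ⟨c, (hcut.mem c).2 (Or.inl rfl)⟩
  have hA := (hg.cut_insert_vertex hcut).1
  have hB := (hg.cut_insert_vertex hcut.symm).1
  have hmem := hcut.mem
  have hcA := hcut.notMem_left
  have hcB := hcut.notMem_right
  have hdis := hcut.disjoint
  have hclB := h.cut_clique hG hx hcut.symm
  obtain ⟨k, hk⟩ : ∃ k, k ∈ K := by
    obtain ⟨a, ha, hxa⟩ := h.exists_cut_adj hx hcut
    exact ⟨a, (hK a).2 ⟨ha, hxa⟩⟩
  have hkW : ∀ k ∈ K, k ∈ W ∧ k ≠ x := fun k hk => by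
    have := (hmem k).2 (Or.inr (Or.inl (hKA hk)))
    exact ⟨Finset.mem_of_mem_erase this, Finset.ne_of_mem_erase this⟩
  have hxk : ∀ k ∈ K, (pendantAt G x K).Adj (some x) (some k) := fun k hk =>
    ⟨((hK k).1 hk).2, fun _ => hk, fun hh => ((hkW k hk).2 hh).elim⟩
  have hconn1 : Conn (pendantAt G x K) (insert (some x) ((W.erase x).map .some)) :=
    (hg.1.pendantAt (by simp)).insert_vertex (a := some k) (by simpa using (hkW k hk).symm) (hxk k hk)
  set U := insert none (insert (some x) ((W.erase x).map Function.Embedding.some)) with hU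
  have hnU : none ∈ U := by simp [hU]
  have hxU : some x ∈ U := by simp [hU]
  have hmU : ∀ u, some u ∈ U ↔ u ∈ W := by
    intro u
    simp only [hU, Finset.mem_insert, reduceCtorEq, false_or, Option.some.injEq, Finset.mem_map,
      Function.Embedding.some_apply, exists_eq_right, Finset.mem_erase]
    constructor
    · rintro (rfl | hh)
      · exact hx
      · exact hh.2
    · intro hh
      by_cases hux : u = x
      · exact Or.inl hux
      · exact Or.inr ⟨hux, hh⟩
  have hadj : ∀ u w, u ≠ x → w ≠ x → G.Adj u w → (pendantAt G x K).Adj (some u) (some w) :=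
    fun u w hu hw huw => ⟨huw, fun hh => (hu hh).elim, fun hh => (hw hh).elim⟩
  refine ⟨hconn1.insert_vertex (a := some x) (by simp) (by simp), ?_⟩
  -- A piece containing `x` but not `none` has boundary vertex `none`, so it is everything else and
  -- nothing is separated from it.
  have noX : ∀ E ⊆ U, ∀ F : Finset (Option V), E.Nonempty → F.Nonempty → F ⊆ U →
      Apart (pendantAt G x K) E F → ∀ v, Bdry (pendantAt G x K) U E v → none ∉ E →
      some x ∉ E := by
    intro E hE F hne ⟨f, hf⟩ hFU hEF v hv hnE hxE
    have hvn : none = v := hv _ hxE none hnU hnE (by simp)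
    subst hvn
    have := hconn1.2 E (fun e he => Finset.mem_of_mem_insert_of_ne (hE he)
      (fun hh => hnE (hh ▸ he))) hne (fun e he u hu heu => by
        by_contra huE
        have := hv e he u (Finset.mem_insert_of_mem hu) huE heu
        subst this
        simp at hu)
    rcases Finset.mem_insert.1 (hFU hf) with rfl | hf'
    · exact (hEF _ hxE _ hf).2 (by simp)
    · exact (hEF f (this hf') f hf).1 rfl
  -- A piece meeting `K` has boundary vertex `x`, so it contains everything except `x` and `none`.
  -- The other two pieces, being separated from it, would both be `{none}`.
  have noK : ∀ E ⊆ U, ∀ F H : Finset (Option V), F.Nonempty → H.Nonempty → F ⊆ U → H ⊆ U →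
      Apart (pendantAt G x K) E F → Apart (pendantAt G x K) E H → Apart (pendantAt G x K) F H →
      ∀ v, Bdry (pendantAt G x K) U E v → none ∉ E → some x ∉ E → ∀ k ∈ K, some k ∉ E := by
    intro E hE F H ⟨f, hf⟩ ⟨t, ht⟩ hFU hHU hEF hEH hFH v hv hnE hxE k hk hkE
    have hvx : some x = v := hv _ hkE _ hxU hxE (hxk k hk).symm
    subst hvx
    have hsub := (hg.1.pendantAt (K := K) (x := x) (by simp)).2 E (fun e he => by
      have h1 := Finset.mem_of_mem_insert_of_ne (hE he) (fun hh => hnE (hh ▸ he))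
      exact Finset.mem_of_mem_insert_of_ne h1 (fun hh => hxE (hh ▸ he))) ⟨_, hkE⟩
      (fun e he u hu heu => by
        by_contra huE
        have := hv e he u (Finset.mem_insert_of_mem (Finset.mem_insert_of_mem hu)) huE heu
        subst this
        simp at hu)
    have hnone : ∀ F : Finset (Option V), F ⊆ U → Apart (pendantAt G x K) E F → ∀ f ∈ F,
        f = none := by
      intro F hFU hEF f hf
      rcases Finset.mem_insert.1 (hFU hf) with hh | hh
      · exact hh
      · rcases Finset.mem_insert.1 hh with rfl | hh
        · exact ((hEF _ hkE _ hf).2 (hxk k hk).symm).elim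
        · exact ((hEF f (hsub hh) f hf).1 rfl).elim
    exact (hFH f hf t ht).1 ((hnone F hFU hEF f hf).trans (hnone H hHU hEH t ht).symm)
  have far : ∀ E ⊆ U, E.Nonempty → ∀ v, Bdry (pendantAt G x K) U E v → none ∉ E → some x ∉ E →
      (∀ k ∈ K, some k ∉ E) → ∃ e, some e ∈ E ∧ (e = c ∨ e ∈ B) ∧ G.Adj x e := by
    intro E hE ⟨e₀, he₀⟩ v hv hnE hxE hKE
    obtain ⟨e₁, rfl⟩ := Option.ne_none_iff_exists'.1 (fun hh => hnE (hh ▸ he₀) : e₀ ≠ none)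
    by_contra! hcon
    have hcon' : ∀ e, some e ∈ E → ¬ G.Adj x e := by
      intro e he hxe
      have he' : e ∈ W.erase x := Finset.mem_erase.2
        ⟨fun hh => hxE (hh ▸ he), (hmU e).1 (hE he)⟩
      rcases (hmem e).1 he' with hh | hh | hh
      · exact hcon e he (Or.inl hh) hxe
      · exact hKE e ((hK e).2 ⟨hh, hxe⟩) he
      · exact hcon e he (Or.inr hh) hxe
    -- The default value `x` is harmless: if `v` is `none`, then `E` has no boundary vertex in `W`.
    have := h.2 (Finset.eraseNone E) (fun u hu => (hmU u).1 (hE (Finset.mem_eraseNone.1 hu)))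
      ⟨e₁, Finset.mem_eraseNone.2 he₀⟩ (v.getD x) (fun e he u hu huE heu => by
        rw [Finset.mem_eraseNone] at he huE
        have hux : u ≠ x := fun hh => hcon' e he (hh ▸ heu.symm)
        have := hv _ he _ ((hmU u).2 hu) huE (hadj e u (fun hh => hxE (hh ▸ he)) hux heu)
        rw [← this]
        simp)
    have h1 := this hx
    have h2 := this (hkW k hk).1
    rw [Finset.mem_insert, Finset.mem_eraseNone] at h1 h2
    rcases h1 with h1 | h1
    · rcases h2 with h2 | h2
      · exact (hkW k hk).2 (h2.trans h1.symm)
      · exact hKE k hk h2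
    · exact hxE h1
  have two : ∀ E ⊆ U, ∀ F ⊆ U, ∀ H ⊆ U, E.Nonempty → F.Nonempty → H.Nonempty →
      Apart (pendantAt G x K) E F → Apart (pendantAt G x K) E H → Apart (pendantAt G x K) F H →
      ∀ v w, Bdry (pendantAt G x K) U E v → Bdry (pendantAt G x K) U F w → none ∉ E → none ∉ F →
      False := by
    intro E hE F hF H hH hne hnf hnh hEF hEH hFH v w hv hw hnE hnF
    have hxE := noX E hE F hne hnf hF hEF v hv hnE
    have hxF := noX F hF E hnf hne hE hEF.symm w hw hnF
    have hKE := noK E hE F H hnf hnh hF hH hEF hEH hFH v hv hnE hxE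
    have hKF := noK F hF E H hne hnh hE hH hEF.symm hFH hEH w hw hnF hxF
    have cross : ∀ E ⊆ U, ∀ F : Finset (Option V), Apart (pendantAt G x K) E F → ∀ v,
        Bdry (pendantAt G x K) U E v → some x ∉ E → (∀ k ∈ K, some k ∉ E) → some c ∈ E →
        ∀ b ∈ B, some b ∈ F → False := by
      intro E hE F hEF v hv hxE hKE hcE b hb hbF
      have hxA : x ∉ insert c A := fun hh => by
        have := (hmem x).2 (by rcases Finset.mem_insert.1 hh with hh | hh <;> simp [hh])
        simp at this
      have hxB : x ∉ insert c B := fun hh => by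
        have := (hmem x).2 (by rcases Finset.mem_insert.1 hh with hh | hh <;> simp [hh])
        simp at this
      refine Bdry.false_of_cut (c := some c) (hA.pendantAt (K := K) hxA) (hB.pendantAt (K := K) hxB)
        ?_ ?_ hv hcE (by simp) (by simp) ?_ ⟨some k, by simp [hKA hk], hKE k hk⟩
        ⟨some b, by simp [hb], fun hh => (hEF _ hh _ hbF).1 rfl⟩
      · intro u hu
        obtain ⟨w, hw, rfl⟩ := Finset.mem_map.1 hu
        refine (hmU w).2 (Finset.mem_of_mem_erase ((hmem w).2 ?_))
        rcases Finset.mem_insert.1 hw with hh | hh <;> simp [hh]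
      · intro u hu
        obtain ⟨w, hw, rfl⟩ := Finset.mem_map.1 hu
        refine (hmU w).2 (Finset.mem_of_mem_erase ((hmem w).2 ?_))
        rcases Finset.mem_insert.1 hw with hh | hh <;> simp [hh]
      · intro u hu hu'
        obtain ⟨w, hw, rfl⟩ := Finset.mem_map.1 hu
        obtain ⟨t, ht, hh⟩ := Finset.mem_map.1 hu'
        cases hh
        rcases Finset.mem_insert.1 hw with rfl | hwA
        · rfl
        · rcases Finset.mem_insert.1 ht with rfl | htB
          · rfl
          · exact (hdis w hwA htB).elim
    obtain ⟨e, he, heB, hxe⟩ := far E hE hne v hv hnE hxE hKE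
    obtain ⟨f, hf, hfB, hxf⟩ := far F hF hnf w hw hnF hxF hKF
    have hef := hEF _ he _ hf
    rcases heB with rfl | heB <;> rcases hfB with rfl | hfB
    · exact hef.1 rfl
    · exact cross E hE F hEF v hv hxE hKE he f hfB hf
    · exact cross F hF E hEF.symm w hw hxF hKF hf e heB he
    · have hne' : e ≠ f := fun hh => hef.1 (by rw [hh])
      exact hef.2 (hadj e f (fun hh => hxE (hh ▸ he)) (fun hh => hxF (hh ▸ hf))
        (hclB e heB f hfB hxe hxf hne'))
  intro E₁ h₁ E₂ h₂ E₃ h₃ n₁ n₂ n₃ v₁ v₂ v₃ b₁ b₂ b₃ a₁₂ a₁₃ a₂₃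
  by_cases o₁ : none ∈ E₁
  · exact two E₂ h₂ E₃ h₃ E₁ h₁ n₂ n₃ n₁ a₂₃ a₁₂.symm a₁₃.symm _ _ b₂ b₃
      (fun hh => (a₁₂ _ o₁ _ hh).1 rfl) (fun hh => (a₁₃ _ o₁ _ hh).1 rfl)
  by_cases o₂ : none ∈ E₂
  · exact two E₁ h₁ E₃ h₃ E₂ h₂ n₁ n₃ n₂ a₁₃ a₁₂ a₂₃.symm _ _ b₁ b₃ o₁
      (fun hh => (a₂₃ _ o₂ _ hh).1 rfl)
  · exact two E₁ h₁ E₂ h₂ E₃ h₃ n₁ n₂ n₃ a₁₂ a₁₃ a₂₃ _ _ b₁ b₂ o₁ o₂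

/-! ### The two neighbours of `x` -/

/-- On each side of a cut vertex of `G - x` there is a neighbour `z` of `x` as desired. -/
lemma NoCut.exists_tiles_erase_erase [Fintype V] (h : NoCut G Finset.univ) (hG : NoClaw G)
    (hcard : Fintype.card V % 3 = 2) (hcut : IsCut G (Finset.univ.erase x) A c B) :
    ∃ z ∈ A, G.Adj x z ∧ Conn G ((Finset.univ.erase x).erase z) ∧
      Tiles G ((Finset.univ.erase x).erase z) := by
  classical
  have hx := Finset.mem_univ x
  have hg := h.good_erase_cut hG hx ⟨c, (hcut.mem c).2 (Or.inl rfl)⟩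
  obtain ⟨A', hA', c', B', hcut', hnc⟩ := hg.exists_end_block hG hcut
  have hB := (hg.cut_insert_vertex hcut'.symm).1
  have hc1 : ((Finset.univ : Finset V).erase x).card = Fintype.card V - 1 :=
    Finset.card_erase_of_mem hx
  have hmem := hcut'.mem
  have hcn : ∀ z ∈ A', Conn G ((Finset.univ.erase x).erase z) := fun z hz =>
    hcut'.conn_erase hnc hB hz
  by_cases hex : ∃ z ∈ A', G.Adj x z ∧ G.Adj c' z
  · obtain ⟨z, hz, hxz, hcz⟩ := hex
    refine ⟨z, hA' hz, hxz, hcn z hz, ?_⟩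
    refine Good.tiles hG _ (h.good_erase_erase hG hx hcut' hnc hz hcz) ?_
    rw [Finset.card_erase_of_mem ((hmem z).2 (Or.inr (Or.inl hz))), hc1]
    omega
  push Not at hex
  obtain ⟨K, hKdef⟩ : ∃ K : Finset V, K = A'.filter (G.Adj x) := ⟨_, rfl⟩
  have hK : ∀ u, u ∈ K ↔ u ∈ A' ∧ G.Adj x u := by
    intro u
    rw [hKdef, Finset.mem_filter]
  have hclA := h.cut_clique hG hx hcut'
  -- A common neighbour of `x` and a vertex of `K` lies in `A'` or is `c'`. The latter is excluded,
  -- as no vertex of `A'` is adjacent to both `x` and `c'`.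
  have hnoclaw : NoClaw (pendantAt G x K) := by
    refine pendantAt_noClaw hG (fun a ha b hb hab => ?_) (fun hh => ((hK x).1 hh).2.ne rfl) ?_
    · have ha' := (hK a).1 ha
      have hb' := (hK b).1 hb
      exact hclA a ha'.1 b hb'.1 ha'.2 hb'.2 hab
    · intro w hw hxw t hwt hxt
      have hwA := ((hK w).1 hw).1
      rcases (hmem t).1 (Finset.mem_erase.2 ⟨hxt.ne.symm, Finset.mem_univ t⟩) with rfl | ht | ht
      · exact (hex w hwA hxw hwt.symm).elim
      · exact (hK t).2 ⟨ht, hxt⟩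
      · exact ((hcut'.apart w hwA t ht).2 hwt).elim
  have hgood := h.good_pendantAt hG hx hcut' (fun u hu => ((hK u).1 hu).1) hK
  have hcard2 : (insert none (insert (some x)
      ((Finset.univ.erase x).map Function.Embedding.some))).card = Fintype.card V + 1 := by
    have := Fintype.card_pos_iff.2 ⟨x⟩
    rw [Finset.card_insert_of_notMem (by simp), Finset.card_insert_of_notMem (by simp),
      Finset.card_map, hc1]
    omega
  -- The pendant vertex forces a path `none`, `x`, `z`, and `z ∈ K` because the other edges at `x`
  -- are gone. The remaining paths use only edges of `G`.
  have hT := Good.tiles hnoclaw _ hgood (by rw [hcard2]; omega)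
  obtain ⟨a, ha, han, hax, -, -, hxa, hT'⟩ := hT.exists_pendant (p := none) (d := some x) (by simp)
    (fun u hu hnu => by
      rcases u with _ | u
      · exact (pendantAt_none_none hnu).elim
      · rw [pendantAt_none_some.1 hnu])
  obtain ⟨z, rfl⟩ := Option.ne_none_iff_exists'.1 han
  have hzK := hxa.2.1 rfl
  have hz := (hK z).1 hzK
  refine ⟨z, hA' hz.1, hz.2, hcn z hz.1, ?_⟩
  have := hT'.eraseNone (by simp)
  convert this using 1
  ext u
  simp only [Finset.mem_erase, Finset.mem_eraseNone, Finset.mem_sdiff, Finset.mem_insert,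
    Finset.mem_singleton, Finset.mem_map, Option.some.injEq, Finset.mem_univ, reduceCtorEq,
    Function.Embedding.some_apply, exists_eq_right]
  clear * -
  tauto

/-- A claw-free graph `G` without cut vertices whose number of vertices is two modulo three. -/
theorem NoCut.exists_tiles [Fintype V] (h : NoCut G Finset.univ) (hG : NoClaw G)
    (hV : 2 < Fintype.card V) (hcard : Fintype.card V % 3 = 2) (x : V) :
    ∃ z₁ z₂, z₁ ≠ z₂ ∧ G.Adj x z₁ ∧ G.Adj x z₂ ∧
      (Conn G ((Finset.univ.erase x).erase z₁) ∧ Tiles G ((Finset.univ.erase x).erase z₁)) ∧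
      (Conn G ((Finset.univ.erase x).erase z₂) ∧ Tiles G ((Finset.univ.erase x).erase z₂)) := by
  have hx := Finset.mem_univ x
  have hc1 : ((Finset.univ : Finset V).erase x).card = Fintype.card V - 1 :=
    Finset.card_erase_of_mem hx
  -- If `G - x` has no cut vertex, any two neighbours of `x` serve. Otherwise one is taken from each
  -- side of a cut vertex.
  by_cases hnc : NoCut G (Finset.univ.erase x)
  · have key : ∀ z, G.Adj x z → Conn G ((Finset.univ.erase x).erase z) ∧
        Tiles G ((Finset.univ.erase x).erase z) := by
      intro z hxz
      have hz : z ∈ Finset.univ.erase x := Finset.mem_erase.2 ⟨hxz.ne.symm, Finset.mem_univ z⟩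
      have hc2 := Finset.card_erase_of_mem hz
      have hg := hnc.good_erase_cut hG hz (Finset.card_pos.1 (by omega))
      exact ⟨hg.1, Good.tiles hG _ hg (by omega)⟩
    have h3 : 3 ≤ (Finset.univ : Finset V).card := hV
    obtain ⟨z₁, -, -, hz₁⟩ := h.exists_adj_ne h3 hx x
    obtain ⟨z₂, -, hne, hz₂⟩ := h.exists_adj_ne h3 hx z₁
    exact ⟨z₁, z₂, hne.symm, hz₁, hz₂, key z₁ hz₁, key z₂ hz₂⟩
  · obtain ⟨A, c, B, hcut⟩ := exists_isCut
      (h.conn_erase (Finset.card_pos.1 (by omega))) hnc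
    obtain ⟨z₁, hz₁, h1⟩ := h.exists_tiles_erase_erase hG hcard hcut
    obtain ⟨z₂, hz₂, h2⟩ := h.exists_tiles_erase_erase hG hcard hcut.symm
    exact ⟨z₁, z₂, fun hh => hcut.disjoint z₁ hz₁ (hh ▸ hz₂), h1.1, h2.1, h1.2, h2.2⟩

/-! ### Translation to and from induced subgraphs and factors -/

lemma noClaw_of_isClawFree {V : Type*} {G : SimpleGraph V} (h : G.IsClawFree) : NoClaw G := by
  intro a b c d hab hac had hbc hbd hcd
  by_contra! hcon
  obtain ⟨n₁, n₂, n₃⟩ := hcon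
  have ncb : ¬ G.Adj c b := fun hh => n₁ hh.symm
  have ndb : ¬ G.Adj d b := fun hh => n₂ hh.symm
  have ndc : ¬ G.Adj d c := fun hh => n₃ hh.symm
  refine h ⟨⟨⟨Sum.elim ![a] ![b, c, d], ?_⟩, fun {i j} => ?_⟩⟩
  · rintro (i | i) (j | j) hij <;> fin_cases i <;> fin_cases j <;>
      simp_all [hab.ne, hac.ne, had.ne, hab.ne.symm, hac.ne.symm, had.ne.symm]
  · change G.Adj (Sum.elim ![a] ![b, c, d] i) (Sum.elim ![a] ![b, c, d] j) ↔ _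
    rcases i with i | i <;> rcases j with j | j <;> fin_cases i <;> fin_cases j <;>
      simp [completeBipartiteGraph, hab, hac, had, hab.symm, hac.symm, had.symm, n₁, n₂, n₃,
        ncb, ndb, ndc]

lemma noCut_of_isVertexConnected [Fintype V] (h : G.IsVertexConnected 2) :
    NoCut G Finset.univ := by
  obtain ⟨hcard, h⟩ := h
  refine ⟨Finset.card_pos.1 (by rw [Finset.card_univ]; omega), fun E _ ⟨d, hd⟩ v hv w _ => ?_⟩
  by_contra hw
  rw [Finset.mem_insert, not_or] at hw
  have key : ∀ S : Set V, (G.induce S).Connected → (∀ u ∈ S, u ∉ E → u ≠ v) → d ∈ S → w ∈ S →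
      False := by
    intro S hS hSE hdS hwS
    obtain ⟨q⟩ := hS.preconnected ⟨d, hdS⟩ ⟨w, hwS⟩
    obtain ⟨e, -, h1, h2⟩ := q.exists_boundary_dart {u | (u : V) ∈ E} hd hw.2
    exact hSE _ e.snd.2 h2 (hv _ h1 _ (Finset.mem_univ _) h2 e.adj)
  -- If `v` lies in `E`, no edge leaves `E` and nothing needs to be deleted. Otherwise deleting `v`
  -- removes every exit.
  by_cases hvE : v ∈ E
  · exact key _ (h ∅ (by simp)) (fun u _ hu hh => hu (hh ▸ hvE)) (by simp) (by simp)
  · exact key _ (h {v} (by simp)) (fun u hu _ => by simpa using hu)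
      (by simpa using fun hh : d = v => hvE (hh ▸ hd)) (by simpa using hw.1)

lemma Conn.connected_induce (h : Conn G U) {S : Set V} (hS : ∀ u, u ∈ S ↔ u ∈ U) :
    (G.induce S).Connected := by
  classical
  obtain ⟨⟨d, hd⟩, hU⟩ := h
  rw [SimpleGraph.connected_iff_exists_forall_reachable]
  refine ⟨⟨d, (hS d).2 hd⟩, fun w => ?_⟩
  have := hU (U.filter fun u => ∃ hu : u ∈ S, (G.induce S).Reachable ⟨d, (hS d).2 hd⟩ ⟨u, hu⟩)
    (Finset.filter_subset _ _) ⟨d, Finset.mem_filter.2 ⟨hd, (hS d).2 hd, .rfl⟩⟩ ?_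
  · obtain ⟨_, _, hr⟩ := Finset.mem_filter.1 (this ((hS w).1 w.2))
    exact hr
  · intro e he u hu heu
    obtain ⟨-, heS, hr⟩ := Finset.mem_filter.1 he
    refine Finset.mem_filter.2 ⟨hu, (hS u).2 hu, hr.trans ?_⟩
    have : (G.induce S).Adj ⟨e, heS⟩ ⟨u, (hS u).2 hu⟩ := heu
    exact this.reachable

/-- The vertices `a`, `b`, `c` form, in this order, a component of `G` that is a path. -/
def IsPathComponent {V : Type*} (G : SimpleGraph V) (a b c : V) : Prop :=
  a ≠ c ∧ ∀ v, (G.Adj a v ↔ v = b) ∧ (G.Adj b v ↔ v = a ∨ v = c) ∧ (G.Adj c v ↔ v = b)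

lemma IsPathComponent.nonempty_iso {V : Type*} {G : SimpleGraph V} {a b c : V}
    (h : IsPathComponent G a b c) (C : G.ConnectedComponent) (hb : b ∈ C.supp) :
    Nonempty (C.toSimpleGraph ≃g SimpleGraph.pathGraph 3) := by
  obtain ⟨hac, h⟩ := h
  have hab : G.Adj a b := ((h b).1).2 rfl
  have hcb : G.Adj c b := ((h b).2.2).2 rfl
  have nac : ¬ G.Adj a c := fun hh => hcb.ne ((h c).1.1 hh)
  have nca : ¬ G.Adj c a := fun hh => nac hh.symm
  have ha : a ∈ C.supp := C.mem_supp_of_adj_mem_supp hb hab.symm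
  have hc : c ∈ C.supp := C.mem_supp_of_adj_mem_supp hb hcb.symm
  have hsub : ∀ u ∈ C.supp, u = a ∨ u = b ∨ u = c := by
    intro u hu
    by_contra hcon
    have hr : G.Reachable b u := SimpleGraph.ConnectedComponent.exact (hb.trans hu.symm)
    obtain ⟨q⟩ := hr
    obtain ⟨e, -, h1, h2⟩ := q.exists_boundary_dart {u | u = a ∨ u = b ∨ u = c}
      (Or.inr (Or.inl rfl)) hcon
    have hadj := e.adj
    rcases h1 with h1 | h1 | h1 <;> rw [h1] at hadj
    · exact h2 (Or.inr (Or.inl ((h _).1.1 hadj)))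
    · rcases (h _).2.1.1 hadj with hh | hh
      · exact h2 (Or.inl hh)
      · exact h2 (Or.inr (Or.inr hh))
    · exact h2 (Or.inr (Or.inl ((h _).2.2.1 hadj)))
  let f : Fin 3 → C.supp := ![⟨a, ha⟩, ⟨b, hb⟩, ⟨c, hc⟩]
  have hf : Function.Bijective f := by
    constructor
    · intro i j hij
      fin_cases i <;> fin_cases j <;>
        simp_all [f, hac.symm, hab.ne, hcb.ne, hab.ne.symm, hcb.ne.symm]
    · rintro ⟨u, hu⟩
      rcases hsub u hu with rfl | rfl | rfl
      · exact ⟨0, rfl⟩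
      · exact ⟨1, rfl⟩
      · exact ⟨2, rfl⟩
  refine ⟨(SimpleGraph.Iso.symm ⟨Equiv.ofBijective f hf, ?_⟩)⟩
  intro i j
  change G.Adj (f i) (f j) ↔ _
  rw [SimpleGraph.pathGraph_adj]
  fin_cases i <;> fin_cases j <;>
    simp [f, hab, hcb, hab.symm, hcb.symm, nac, nca]

/-- The condition that all edges of `F` lie inside `U` carries the induction: a path added later is
then disjoint from `F` and forms a component of its own. -/
lemma Tiles.exists_isPathComponent (h : Tiles G U) :
    ∃ F ≤ G, (∀ u w, F.Adj u w → u ∈ U) ∧ ∀ u ∈ U, ∃ a ∈ U, ∃ b ∈ U, ∃ c ∈ U,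
      (u = a ∨ u = b ∨ u = c) ∧ IsPathComponent F a b c := by
  induction h with
  | empty => exact ⟨⊥, bot_le, by simp, by simp⟩
  | @step U a b c _ hab hbc hac ha hb hc ih =>
    obtain ⟨F, hF, hsub, hcov⟩ := ih
    have hab' := hab.ne
    have hbc' := hbc.ne
    have hadj : ∀ u w, (F ⊔ SimpleGraph.fromEdgeSet {s(a, b), s(b, c)}).Adj u w ↔
        F.Adj u w ∨ (u = a ∧ w = b ∨ u = b ∧ w = a ∨ u = b ∧ w = c ∨ u = c ∧ w = b) := by
      intro u w
      rw [SimpleGraph.sup_adj, SimpleGraph.fromEdgeSet_adj]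
      simp only [Set.mem_insert_iff, Set.mem_singleton_iff, Sym2.eq_iff]
      clear * - hab' hbc'
      grind
    refine ⟨F ⊔ SimpleGraph.fromEdgeSet {s(a, b), s(b, c)}, ?_, ?_, ?_⟩
    · intro u w huw
      rcases (hadj u w).1 huw with hh | ⟨rfl, rfl⟩ | ⟨rfl, rfl⟩ | ⟨rfl, rfl⟩ | ⟨rfl, rfl⟩
      · exact hF hh
      · exact hab
      · exact hab.symm
      · exact hbc
      · exact hbc.symm
    · intro u w huw
      rcases (hadj u w).1 huw with hh | ⟨rfl, rfl⟩ | ⟨rfl, rfl⟩ | ⟨rfl, rfl⟩ | ⟨rfl, rfl⟩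
      · simp [hsub u w hh]
      all_goals simp
    · intro u hu
      by_cases huU : u ∈ U
      · obtain ⟨a', ha', b', hb', c', hc', hu', hne, hp⟩ := hcov u huU
        have old : ∀ e ∈ U, ∀ w, (F ⊔ SimpleGraph.fromEdgeSet {s(a, b), s(b, c)}).Adj e w ↔
            F.Adj e w := by
          intro e he w
          rw [hadj]
          clear * - he ha hb hc
          grind
        refine ⟨a', by simp [ha'], b', by simp [hb'], c', by simp [hc'], hu', hne, fun v => ?_⟩
        rw [old a' ha', old b' hb', old c' hc']
        exact hp v
      · have hn : ∀ e ∉ U, ∀ w, ¬ F.Adj e w := fun e he w hew => he (hsub e w hew)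
        refine ⟨a, by simp, b, by simp, c, by simp, ?_, hac, fun v => ?_⟩
        · simpa [huU] using hu
        · have h1 := hn a ha v
          have h2 := hn b hb v
          have h3 := hn c hc v
          rw [hadj, hadj, hadj]
          clear * - h1 h2 h3 hab' hbc' hac
          grind

lemma Tiles.hasLambdaFactor (h : Tiles G U) {S : Set V} (hS : ∀ u, u ∈ S ↔ u ∈ U) :
    (G.induce S).HasLambdaFactor := by
  obtain ⟨F, hF, -, hcov⟩ := h.exists_isPathComponent
  refine ⟨F.induce S, fun u w huw => hF huw, fun C => ?_⟩
  obtain ⟨⟨u, hu⟩, rfl⟩ := C.exists_rep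
  obtain ⟨a, ha, b, hb, c, hc, huabc, hne, hp⟩ := hcov u ((hS u).1 hu)
  rw [← hS] at ha hb hc
  have hpath : IsPathComponent (F.induce S) ⟨a, ha⟩ ⟨b, hb⟩ ⟨c, hc⟩ := by
    refine ⟨by simpa using hne, fun v => ?_⟩
    simpa [Subtype.ext_iff] using hp v
  refine hpath.nonempty_iso _ ?_
  have hab : (F.induce S).Adj ⟨b, hb⟩ ⟨a, ha⟩ := ((hp a).2.1).2 (Or.inl rfl)
  have hcb : (F.induce S).Adj ⟨b, hb⟩ ⟨c, hc⟩ := ((hp c).2.1).2 (Or.inr rfl)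
  rcases huabc with rfl | rfl | rfl
  · exact SimpleGraph.ConnectedComponent.sound hab.reachable
  · rfl
  · exact SimpleGraph.ConnectedComponent.sound hcb.reachable

end LambdaFactor

theorem mainTheorem11 {V : Type*} [Fintype V] (G : SimpleGraph V)
    (h2 : G.IsVertexConnected 2) (hclaw : G.IsClawFree)
    (hcard : Fintype.card V % 3 = 2) (x : V) :
    ∃ z₁ z₂ : V, z₁ ≠ z₂ ∧ G.Adj x z₁ ∧ G.Adj x z₂ ∧
      ((G.induce (({x, z₁} : Set V)ᶜ)).Connected ∧
        (G.induce (({x, z₁} : Set V)ᶜ)).HasLambdaFactor) ∧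
      ((G.induce (({x, z₂} : Set V)ᶜ)).Connected ∧
        (G.induce (({x, z₂} : Set V)ᶜ)).HasLambdaFactor) := by
  classical
  have hS : ∀ z u, u ∈ ({x, z} : Set V)ᶜ ↔ u ∈ (Finset.univ.erase x).erase z := by
    intro z u
    simp [and_comm]
  obtain ⟨z₁, z₂, hne, hz₁, hz₂, ⟨c₁, t₁⟩, c₂, t₂⟩ :=
    (LambdaFactor.noCut_of_isVertexConnected h2).exists_tiles
      (LambdaFactor.noClaw_of_isClawFree hclaw) h2.1 hcard x
  exact ⟨z₁, z₂, hne, hz₁, hz₂, ⟨c₁.connected_induce (hS z₁), t₁.hasLambdaFactor (hS z₁)⟩,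
    c₂.connected_induce (hS z₂), t₂.hasLambdaFactor (hS z₂)⟩
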